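/- Let $M$ be a smooth manifold of dimension $m$ and let $A\to M$ be a smooth (real or complex) vector bundle of rank $n$. Suppose that $A$ and its dual $A^*$ carry Lie algebroid structures $(A,[\cdot,\cdot],\rho)$ and $(A^*,[\cdot,\cdot]_*,\rho_*)$, with differentials $d$ on $\Gamma(\wedge^\bullet A^*)$ and $d_*$ on $\Gamma(\wedge^\bullet A)$, and that $(A,A^*)$ is a Lie bialgebroid, i.e. $d_*$ is a derivation of the Gerstenhaber algebra $(\Gamma(\wedge^\bullet A),\wedge,[\cdot,\cdot])$: $$d_*[u,v]=[d_*u,v]+(-1)^{k-1}[u,d_*v]\qquad (u\in\Gamma(\wedge^kA),\ v\in\Gamma(\wedge^lA)).$$ (In the complex case, functions, the anchors and forms on $M$ are complexified.) For $u\in\Gamma(A)$, let $\mathcal L_u$ denote the Lie derivative of the Lie algebroid $A$: on $\Gamma(\wedge^\bullet A^*)$ it is $\iota_u d+d\,\iota_u$, on $\Gamma(\wedge^\bullet A)$ it is $[u,\cdot]$, and on differential forms on $M$ it is the usual Lie derivative along $\rho(u)$. For $\theta\in\Gamma(A^*)$, $\mathcal L_\theta$ is defined likewise from the Lie algebroid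 $A^*$. Let $s\in\Gamma(\wedge^mT^*M)$ be a volume form, $\Omega\in\Gamma(\wedge^nA^*)$ a nowhere vanishing section, and $V\in\Gamma(\wedge^nA)$ the section dual to it, $\langle\Omega,V\rangle=1$. Let $X_0\in\Gamma(A)$ and $\xi_0\in\Gamma(A^*)$ be the modular cocycles, i.e. the sections determined by $$(\mathcal L_\theta\Omega)\otimes s+\Omega\otimes\mathcal L_\theta s=\langle X_0,\theta\rangle\,\Omega\otimes s\quad\text{for all }\theta\in\Gamma(A^*),$$ $$(\mathcal L_us)\otimes V+s\otimes\mathcal L_uV=\langle\xi_0,u\rangle\,s\otimes V\quad\text{for all }u\in\Gamma(A).$$ For $u\in\Gamma(A)$ and $\theta\in\Gamma(A^*)$ let $\partial u$ and $\partial_*\theta$ be the functions determined by $(\partial u)\,\Omega=-d(\iota_u\Omega)$ and $(\partial_*\theta)\,V=-d_*(\iota_\theta V)$; these are the values on sections of the Batalin–Vilkovisky operators dual to $d$ with respect to $\Omega$ and to $d_*$ with respect to $V$. Then 1. $\mathcal L_{X_0}V=-\mathcal L_{\xi_0}V$; 2. $\mathcal L_{X_0}\Omega=-\mathcal L_{\xi_0}\Omega$;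 3. $\partial_*\xi_0=\partial X_0$; 4. $\mathcal L_{X_0}s=\mathcal L_{\xi_0}s$. -/

import Mathlib

open Bundle Module
open scoped Manifold ContDiff Topology

noncomputable section

/-! ### Lie algebroids in terms of sections

`R` is the ring of smooth functions, `L` the `R`-module of sections of a vector bundle, and
`Dual R L` the module of sections of the dual bundle.  Vector fields are derivations of `R`. -/

section Algebra

variable {R : Type*} [CommRing R] [Algebra ℝ R]
variable {L : Type*} [AddCommGroup L] [Module R L]

variable (R L) in
/-- A Lie algebroid structure on a vector bundle with module of sections `L`: a Lie bracket on
sections and an anchor, i.e. an `R`-linear map to vector fields, which is a morphism for the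
brackets and satisfies the Leibniz rule.  (Linearity of the bracket over the constants follows
from the Leibniz rule.) -/
structure LieAlgebroid where
  bracket : L →+ L →+ L
  anchor : L →ₗ[R] Derivation ℝ R R
  bracket_self : ∀ X, bracket X X = 0
  jacobi : ∀ X Y Z, bracket X (bracket Y Z) = bracket (bracket X Y) Z + bracket Y (bracket X Z)
  anchor_bracket : ∀ X Y, anchor (bracket X Y) = ⁅anchor X, anchor Y⁆
  leibniz : ∀ (X : L) (f : R) (Y : L), bracket X (f • Y) = anchor X f • Y + f • bracket X Y

/-- Given a vector field `D` and an operator `δ` on sections, the induced operator on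
`k`-cochains (`R`-valued functions of `k` sections, in particular `k`-forms):
`(D·α)(Y₁, …, Y_k) = D (α(Y₁, …, Y_k)) - ∑ᵢ α(Y₁, …, δ Yᵢ, …, Y_k)`. -/
def cochainLie (D : Derivation ℝ R R) (δ : L → L) {k : ℕ} (α : (Fin k → L) → R) :
    (Fin k → L) → R :=
  fun Y => D (α Y) - ∑ i, α (Function.update Y i (δ (Y i)))

/-- Insertion of a section in the first slot, `ι_X α`. -/
def insertFirst (X : L) {k : ℕ} (α : (Fin (k + 1) → L) → R) : (Fin k → L) → R :=
  fun Y => α (Fin.cons X Y)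

/-- The Lie derivative of an `m`-form on the base manifold along a vector field. -/
def vectorFieldLie (D : Derivation ℝ R R) {k : ℕ} (s : (Fin k → Derivation ℝ R R) → R) :
    (Fin k → Derivation ℝ R R) → R :=
  cochainLie D (fun Y => ⁅D, Y⁆) s

namespace LieAlgebroid

variable (𝒜 : LieAlgebroid R L)

/-- The Lie algebroid differential of a `k`-form. -/
def d : {k : ℕ} → ((Fin k → L) → R) → (Fin (k + 1) → L) → R
  | 0, α => fun X => 𝒜.anchor (X 0) (α Fin.elim0)
  | k + 1, α => fun X =>
      ∑ i : Fin (k + 2), (-1) ^ (i : ℕ) * 𝒜.anchor (X i) (α (i.removeNth X))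
      + ∑ j : Fin (k + 2), ∑ i : Fin (k + 1) with i.castSucc < j, (-1) ^ ((i : ℕ) + (j : ℕ)) *
          α (Fin.cons (𝒜.bracket (X i.castSucc) (X j)) (i.removeNth (j.removeNth X)))

/-- The differential of a function, as a section of the dual bundle. -/
def dFun (f : R) : Dual R L where
  toFun X := 𝒜.anchor X f
  map_add' := by simp
  map_smul' := by simp

/-- The Lie derivative `L_X α` of a `k`-form on the Lie algebroid (a section of `∧ᵏ` of the dual
bundle): `(L_X α)(Y₁, …) = ρ(X)(α(Y₁, …)) - ∑ᵢ α(…, [X, Yᵢ], …)`. -/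
def lieForm (X : L) {k : ℕ} (α : (Fin k → L) → R) : (Fin k → L) → R :=
  cochainLie (𝒜.anchor X) (𝒜.bracket X) α

/-- The Lie derivative `L_X θ` of a section of the dual bundle:
`⟨L_X θ, Y⟩ = ρ(X)⟨θ, Y⟩ - ⟨θ, [X, Y]⟩`. -/
def lieDual (X : L) (θ : Dual R L) : Dual R L where
  toFun Y := 𝒜.anchor X (θ Y) - θ (𝒜.bracket X Y)
  map_add' Y Z := by simp only [map_add]; ring
  map_smul' f Y := by
    simp only [map_smul, 𝒜.leibniz, map_add, smul_eq_mul, Derivation.leibniz, RingHom.id_apply]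
    ring

/-- The Lie derivative `L_X P = [X, P]` of a `k`-vector `P` (a section of `∧ᵏ` of the bundle itself,
viewed as an alternating form on the dual bundle): the derivation of the exterior algebra
extending the bracket, i.e. `(L_X P)(θ₁, …) = ρ(X)(P(θ₁, …)) - ∑ᵢ P(…, L_X θᵢ, …)`. -/
def lieVec (X : L) {k : ℕ} (P : (Fin k → Dual R L) → R) : (Fin k → Dual R L) → R :=
  cochainLie (𝒜.anchor X) (𝒜.lieDual X) P

/-- The Schouten bracket `[P, f] = (-1)ᵏ ι_{df} P` of a `(k+1)`-vector with a function. -/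
def schoutenFun {k : ℕ} (P : (Fin (k + 1) → Dual R L) → R) (f : R) : (Fin k → Dual R L) → R :=
  (-1 : R) ^ k • insertFirst (𝒜.dFun f) P

end LieAlgebroid

/-! ### Pairs of Lie algebroid structures in duality -/

/-- A section `X` as a `1`-vector, i.e. as a form of degree one on the dual bundle. -/
def oneVec (X : L) : (Fin 1 → Dual R L) → R := fun θ => θ 0 X

/-- A function as a `0`-vector. -/
def zeroVec (f : R) : (Fin 0 → Dual R L) → R := fun _ => f

/-- `(A, A*)` is a Lie bialgebroid: the differential `d_*` of `A*`, acting on multivectors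
(sections of `∧A`), is a derivation of the Gerstenhaber bracket of `A`,
`d_*[u, v] = [d_* u, v] + (-1)^(k-1) [u, d_* v]` for `u` of degree `k`.
As `d_*` is a derivation of `∧` and the bracket is a graded-antisymmetric biderivation of `∧`,
this is a condition on the generators of `Γ(∧A)`, i.e. on functions and sections; it is stated
on these. The cases of degrees `(0, 0)`, `(1, 0)`, `(1, 1)` are
`0 = [d_* f, g] - [f, d_* g]`, where `[f, d_* g] = -[d_* g, f]`;
`d_*[X, f] = [d_* X, f] + [X, d_* f]`; and
`d_*[X, Y] = [d_* X, Y] + [X, d_* Y]`, where `[d_* X, Y] = -[Y, d_* X] = -L_Y (d_* X)`. -/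
structure IsLieBialgebroid (𝒜 : LieAlgebroid R L) (𝒜' : LieAlgebroid R (Dual R L)) : Prop where
  fun_fun : ∀ f g : R,
    𝒜.schoutenFun (𝒜'.d (zeroVec f)) g + 𝒜.schoutenFun (𝒜'.d (zeroVec g)) f = 0
  sec_fun : ∀ (X : L) (f : R),
    𝒜'.d (zeroVec (𝒜.anchor X f)) =
      𝒜.schoutenFun (𝒜'.d (oneVec X)) f + 𝒜.lieVec X (𝒜'.d (zeroVec f))
  sec_sec : ∀ X Y : L,
    𝒜'.d (oneVec (𝒜.bracket X Y)) =
      -𝒜.lieVec Y (𝒜'.d (oneVec X)) + 𝒜.lieVec X (𝒜'.d (oneVec Y))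

/-- For `θ ∈ Γ(A*)` and `u ∈ Γ(A) = Γ(A**)`, the Lie derivative `L_θ u ∈ Γ(A)` for the Lie
algebroid `A*`: `⟨L_θ u, η⟩ = ρ_*(θ)⟨u, η⟩ - ⟨u, [θ, η]_*⟩`. -/
def lieBidual [IsReflexive R L] (𝒜' : LieAlgebroid R (Dual R L)) (θ : Dual R L) (u : L) : L :=
  (evalEquiv R L).symm (𝒜'.lieDual θ (Dual.eval R L u))

/-- For `θ ∈ Γ(A*)`, the Lie derivative `L_θ Ω = [θ, Ω]_*` of a section `Ω` of `∧ᵏA*`, viewed as an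
alternating form on `A = A**`. -/
def lieCovec [IsReflexive R L] (𝒜' : LieAlgebroid R (Dual R L)) (θ : Dual R L) {k : ℕ}
    (Ω : (Fin k → L) → R) : (Fin k → L) → R :=
  cochainLie (𝒜'.anchor θ) (lieBidual 𝒜' θ) Ω

/-- `V ∈ Γ(∧ⁿA)` is dual to `Ω ∈ Γ(∧ⁿA*)`, `n` the rank of `A`: `⟨Ω, V⟩ = 1`, i.e.
`u₁ ∧ ⋯ ∧ uₙ = Ω(u₁, …, uₙ) V` for all sections `u₁, …, uₙ` of `A`, where `u₁ ∧ ⋯ ∧ uₙ` is the form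
`(θ₁, …, θₙ) ↦ det (θᵢ(uⱼ))` on `A*`. -/
def IsDualVolume {n : ℕ} (Ω : L [⋀^Fin n]→ₗ[R] R) (V : Dual R L [⋀^Fin n]→ₗ[R] R) : Prop :=
  ∀ (u : Fin n → L) (θ : Fin n → Dual R L),
    Matrix.det (Matrix.of fun i j => θ i (u j)) = Ω u * V θ

/-- `∂X = f`, for `X` a section of a Lie algebroid of rank `n` and `Ω` a nowhere vanishing form of
top degree `n`: the operator `∂` is dual to the differential, `ι_{∂β} Ω = (-1)ˡ d(ι_β Ω)` on
`l`-vectors `β`; on sections, `(∂X) Ω = -d(ι_X Ω)` (and `ι_X Ω = 0`, so `∂X = 0`, if `n = 0`). -/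
def LieAlgebroid.IsBV (𝒜 : LieAlgebroid R L) :
    {n : ℕ} → ((Fin n → L) → R) → L → R → Prop
  | 0, Ω, _, f => f • Ω = 0
  | _ + 1, Ω, X, f => f • Ω = -𝒜.d (insertFirst X Ω)

/-- `X₀ ∈ Γ(A)` is the modular cocycle of `A*` with respect to `Ω` and `s`:
`(L_θ Ω) ⊗ s + Ω ⊗ L_{ρ_*(θ)} s = ⟨X₀, θ⟩ Ω ⊗ s` for all `θ ∈ Γ(A*)`. -/
def IsModularCocycleDual [IsReflexive R L] (𝒜' : LieAlgebroid R (Dual R L)) {n m : ℕ}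
    (Ω : (Fin n → L) → R) (s : (Fin m → Derivation ℝ R R) → R) (X₀ : L) : Prop :=
  ∀ (θ : Dual R L) (u : Fin n → L) (Y : Fin m → Derivation ℝ R R),
    lieCovec 𝒜' θ Ω u * s Y + Ω u * vectorFieldLie (𝒜'.anchor θ) s Y = θ X₀ * (Ω u * s Y)

/-- `ξ₀ ∈ Γ(A*)` is the modular cocycle of `A` with respect to `s` and `V`:
`(L_{ρ(u)} s) ⊗ V + s ⊗ L_u V = ⟨ξ₀, u⟩ s ⊗ V` for all `u ∈ Γ(A)`. -/
def IsModularCocycle (𝒜 : LieAlgebroid R L) {n m : ℕ}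
    (s : (Fin m → Derivation ℝ R R) → R) (V : (Fin n → Dual R L) → R) (ξ₀ : Dual R L) : Prop :=
  ∀ (u : L) (Y : Fin m → Derivation ℝ R R) (θ : Fin n → Dual R L),
    vectorFieldLie (𝒜.anchor u) s Y * V θ + s Y * 𝒜.lieVec u V θ = ξ₀ u * (s Y * V θ)

end Algebra

/-! ### Smooth real or complex vector bundles -/

section Geometry

/-- Multiplication in `𝕜 = ℝ` or `ℂ` is smooth over `ℝ`. -/
instance instContMDiffRingRCLike {𝕜 : Type*} [RCLike 𝕜] {n : ℕ∞ω} :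
    ContMDiffRing 𝓘(ℝ, 𝕜) n 𝕜 :=
  { instNormedSpaceLieAddGroup with
    contMDiff_mul := by
      rw [← modelWithCornersSelf_prod, chartedSpaceSelf_prod]
      exact contDiff_mul.contMDiff }

variable {m : ℕ} {M : Type*} [TopologicalSpace M] [ChartedSpace (EuclideanSpace ℝ (Fin m)) M]

variable (𝕜 : Type*) [RCLike 𝕜] (m M) in
/-- The ring `C^∞(M, 𝕜)` of smooth `𝕜`-valued functions on a real manifold `M`. -/
abbrev SmoothFun : Type _ := C^∞⟮𝓡 m, M; 𝓘(ℝ, 𝕜), 𝕜⟯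

variable {𝕜 : Type*} [RCLike 𝕜]
  {F : Type*} [NormedAddCommGroup F] [NormedSpace ℝ F] [NormedSpace 𝕜 F] [IsScalarTower ℝ 𝕜 F]
  {A : M → Type*} [TopologicalSpace (TotalSpace F A)] [∀ x, TopologicalSpace (A x)]
  [∀ x, AddCommGroup (A x)] [∀ x, Module ℝ (A x)] [∀ x, Module 𝕜 (A x)]
  [FiberBundle F A] [VectorBundle ℝ F A] [VectorBundle 𝕜 F A]

variable (F A) (m) in
/-- The smooth sections of a vector bundle over `M`. -/
abbrev SmoothSec : Type _ := Cₛ^∞⟮𝓡 m; F, A⟯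

/-- The product of a smooth `𝕜`-valued function and a smooth section. -/
instance instSMulSmoothSec : SMul (SmoothFun m M 𝕜) (SmoothSec m F A) where
  smul f σ :=
    { toFun := fun x => f x • σ x
      contMDiff_toFun := by
        intro x₀
        have hσ := σ.contMDiff x₀
        rw [contMDiffAt_section] at hσ ⊢
        set e := trivializationAt F A x₀
        have h : ContMDiffAt (𝓡 m) 𝓘(ℝ, F) ∞ (fun x => f x • (e ⟨x, σ x⟩).2) x₀ :=
          (contDiff_smul (𝕜 := ℝ) (𝕜' := 𝕜) (F := F)).contMDiff.contMDiffAt.comp x₀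
            ((f.contMDiff x₀).prodMk_space hσ)
        refine h.congr_of_eventuallyEq ?_
        filter_upwards [e.open_baseSet.mem_nhds (mem_baseSet_trivializationAt F A x₀)] with x hx
        exact (e.linear 𝕜 hx).2 _ _ }

/-- `Γ(A)` as a module over `C^∞(M, 𝕜)`. -/
instance instModuleSmoothSec : Module (SmoothFun m M 𝕜) (SmoothSec m F A) where
  one_smul σ := by ext x; exact one_smul 𝕜 (σ x)
  mul_smul f g σ := by ext x; exact mul_smul (f x) (g x) (σ x)
  smul_zero f := by ext x; exact smul_zero (f x)
  smul_add f σ τ := by ext x; exact smul_add (f x) (σ x) (τ x)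
  add_smul f g σ := by ext x; exact add_smul (f x) (g x) (σ x)
  zero_smul σ := by ext x; exact zero_smul 𝕜 (σ x)

/-- Near each point a smooth vector bundle has a frame, cut off by a bump function `χ`. -/
theorem exists_cutoff_frame [FiniteDimensional 𝕜 F] [T2Space M] [IsManifold (𝓡 m) ∞ M]
    [ContMDiffVectorBundle ∞ F A (𝓡 m)] (x₀ : M) :
    ∃ (χ : SmoothFun m M 𝕜) (σ : Fin (finrank 𝕜 F) → SmoothSec m F A)
      (θ : Fin (finrank 𝕜 F) → Dual (SmoothFun m M 𝕜) (SmoothSec m F A)),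
      (∀ᶠ x in 𝓝 x₀, χ x = 1) ∧ (∀ u, (χ * χ) • u = ∑ i, θ i u • σ i) ∧
      ∀ i u v x, u x = v x → θ i u x = θ i v x := by
  set e := trivializationAt F A x₀ with he
  have hx₀ : x₀ ∈ e.baseSet := mem_baseSet_trivializationAt F A x₀
  obtain ⟨f, hf, -⟩ := (SmoothBumpFunction.nhds_basis_support (I := 𝓡 m)
    (e.open_baseSet.mem_nhds hx₀)).mem_iff.1 (e.open_baseSet.mem_nhds hx₀)
  let b := finBasis 𝕜 F
  have hsm : ∀ (x : M) (r : ℝ) (v : A x), x ∈ e.baseSet → r • v = (r : 𝕜) • v := by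
    intro x r v hx
    apply (e.continuousLinearEquivAt 𝕜 x hx).injective
    have h1 := (e.linear ℝ hx).2 r v
    have h2 := (e.linear 𝕜 hx).2 (r : 𝕜) v
    have h3 : (r : 𝕜) • (e ⟨x, v⟩).2 = r • (e ⟨x, v⟩).2 := by
      exact algebraMap_smul 𝕜 r (e ⟨x, v⟩).2
    exact h1.trans (h3.symm.trans h2.symm)
  have hcoord : ∀ i, ContDiff ℝ ∞ (fun w : F => b.repr w i) := fun i =>
    ((LinearMap.toContinuousLinearMap (b.coord i)).restrictScalars ℝ).contDiff
  let χ : SmoothFun m M 𝕜 := ⟨fun x => ((f x : ℝ) : 𝕜),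
    (RCLike.ofRealCLM (K := 𝕜)).contDiff.contMDiff.comp f.contMDiff⟩
  let σ : Fin (finrank 𝕜 F) → SmoothSec m F A := fun i =>
    ⟨(f : M → ℝ) • fun x => e.symm x (b i), by
      refine ContMDiffOn.smul_section_of_tsupport f.contMDiff.contMDiffOn e.open_baseSet hf ?_
      rw [e.contMDiffOn_section_baseSet_iff]
      refine (contMDiffOn_const (c := b i)).congr fun x hx => ?_
      rw [e.apply_mk_symm hx]⟩
  have hθ : ∀ (i) (u : SmoothSec m F A),
      ContMDiff (𝓡 m) 𝓘(ℝ, 𝕜) ∞ (fun x => f x • b.repr (e ⟨x, u x⟩).2 i) := by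
    intro i u
    refine contMDiff_of_tsupport fun x hx => ?_
    have hxe : x ∈ e.baseSet := hf (tsupport_smul_subset_left _ _ hx)
    have hu := (e.contMDiffAt_section_iff hxe).1 (u.contMDiff x)
    exact f.contMDiffAt.smul ((hcoord i).contMDiff.contMDiffAt.comp x hu)
  have hzero : ∀ x, x ∉ e.baseSet → f x = 0 := fun x hx =>
    image_eq_zero_of_notMem_tsupport fun h => hx (hf h)
  let θ : Fin (finrank 𝕜 F) → Dual (SmoothFun m M 𝕜) (SmoothSec m F A) := fun i =>
    { toFun := fun u => ⟨_, hθ i u⟩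
      map_add' := by
        intro u v
        ext x
        change f x • b.repr (e ⟨x, u x + v x⟩).2 i =
          f x • b.repr (e ⟨x, u x⟩).2 i + f x • b.repr (e ⟨x, v x⟩).2 i
        by_cases hx : x ∈ e.baseSet
        · rw [(e.linear 𝕜 hx).1 (u x) (v x)]
          simp [smul_add]
        · simp [hzero x hx]
      map_smul' := by
        intro g u
        ext x
        change f x • b.repr (e ⟨x, g x • u x⟩).2 i = g x * (f x • b.repr (e ⟨x, u x⟩).2 i)
        by_cases hx : x ∈ e.baseSet
        · rw [(e.linear 𝕜 hx).2 (g x) (u x)]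
          simp
        · simp [hzero x hx] }
  refine ⟨χ, σ, θ, ?_, ?_, ?_⟩
  · filter_upwards [f.eventuallyEq_one] with x hx
    change ((f x : ℝ) : 𝕜) = 1
    rw [hx]; simp
  · intro u
    ext x
    have hsum : (∑ i, θ i u • σ i : SmoothSec m F A) x = ∑ i, (θ i u • σ i) x := by
      have := congrFun (map_sum (ContMDiffSection.coeAddHom (𝓡 m) F ∞ A)
        (fun i => θ i u • σ i) Finset.univ) x
      rw [Finset.sum_apply] at this
      exact this
    rw [hsum]
    change (((f x : ℝ) : 𝕜) * ((f x : ℝ) : 𝕜)) • u x =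
      ∑ i, (f x • b.repr (e ⟨x, u x⟩).2 i) • (f x • e.symm x (b i))
    by_cases hx : x ∈ e.baseSet
    · have hu : u x = ∑ i, b.repr (e ⟨x, u x⟩).2 i • e.symm x (b i) := by
        apply (e.continuousLinearEquivAt 𝕜 x hx).injective
        rw [map_sum]
        simp only [map_smul]
        have h1 : ∀ i, e.continuousLinearEquivAt 𝕜 x hx (e.symm x (b i)) = b i := fun i => by
          change (e ⟨x, e.symm x (b i)⟩).2 = b i
          rw [e.apply_mk_symm hx]
        simp only [h1]
        exact (b.sum_repr _).symm
      conv_lhs => rw [hu]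
      rw [Finset.smul_sum]
      refine Finset.sum_congr rfl fun i _ => ?_
      rw [hsm x (f x) _ hx, smul_smul, smul_smul, RCLike.real_smul_eq_coe_mul]
      ring_nf
    · simp [hzero x hx]
  · intro i u v x h
    change f x • b.repr (e ⟨x, u x⟩).2 i = f x • b.repr (e ⟨x, v x⟩).2 i
    rw [h]

/-- `Γ(A) = Γ(A**)`: the module of sections of a smooth vector bundle is reflexive. -/
instance instIsReflexiveSmoothSec [FiniteDimensional 𝕜 F] [T2Space M] [IsManifold (𝓡 m) ∞ M]
    [ContMDiffVectorBundle ∞ F A (𝓡 m)] :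
    IsReflexive (SmoothFun m M 𝕜) (SmoothSec m F A) where
  bijective_dual_eval' := by
    choose χ σ θ h1 h2 h3 using fun x₀ : M =>
      exists_cutoff_frame (m := m) (𝕜 := 𝕜) (F := F) (A := A) x₀
    have hsum : ∀ {ι : Type} (t : Finset ι) (g : ι → SmoothSec m F A) (x : M),
        (∑ i ∈ t, g i) x = ∑ i ∈ t, g i x := by
      intro ι t g x
      have := congrFun (map_sum (ContMDiffSection.coeAddHom (𝓡 m) F ∞ A) g t) x
      rw [Finset.sum_apply] at this
      exact this
    have hsumR : ∀ {ι : Type} (t : Finset ι) (g : ι → SmoothFun m M 𝕜) (x : M),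
        (∑ i ∈ t, g i) x = ∑ i ∈ t, g i x := by
      intro ι t g x
      have := congrFun (map_sum (ContMDiffMap.coeFnAddMonoidHom
        (I := 𝓡 m) (I' := 𝓘(ℝ, 𝕜)) (N := M) (n := ∞) (G := 𝕜)) g t) x
      rw [Finset.sum_apply] at this
      exact this
    have h2' : ∀ x₀ y (u : SmoothSec m F A), χ x₀ y = 1 →
        u y = ∑ i, θ x₀ i u y • σ x₀ i y := by
      intro x₀ y u hy
      have := congrArg (fun s : SmoothSec m F A => s y) (h2 x₀ u)
      simp only [hsum] at this
      change (χ x₀ y * χ x₀ y) • u y = ∑ i, θ x₀ i u y • σ x₀ i y at this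
      simpa [hy] using this
    -- sections are separated at each point by dual sections
    have hsep : ∀ y (u v : SmoothSec m F A),
        (∀ η : Dual (SmoothFun m M 𝕜) (SmoothSec m F A), η u y = η v y) → u y = v y := by
      intro y u v h
      rw [h2' y y u (h1 y).self_of_nhds, h2' y y v (h1 y).self_of_nhds]
      simp only [h]
    have hloc : ∀ (η : Dual (SmoothFun m M 𝕜) (SmoothSec m F A)) x₀ y u, χ x₀ y = 1 →
        η u y = ∑ i, θ x₀ i u y * η (σ x₀ i) y := by
      intro η x₀ y u hy
      have := congrArg (fun g : SmoothFun m M 𝕜 => g y) (congrArg η (h2 x₀ u))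
      simp only [map_smul, map_sum, hsumR] at this
      change (χ x₀ y * χ x₀ y) * η u y = ∑ i, θ x₀ i u y * η (σ x₀ i) y at this
      simpa [hy] using this
    constructor
    · intro u v h
      ext y
      refine hsep y u v fun η => ?_
      have := congrArg (fun φ => φ η y) h
      simpa using this
    · intro φ
      let w : M → SmoothSec m F A := fun x₀ => ∑ i, φ (θ x₀ i) • σ x₀ i
      have hw : ∀ (η : Dual (SmoothFun m M 𝕜) (SmoothSec m F A)) x₀ y, χ x₀ y = 1 →
          η (w x₀) y = φ η y := by
        intro η x₀ y hy
        have h4 : (χ x₀ * χ x₀) • η = ∑ i, η (σ x₀ i) • θ x₀ i := by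
          ext1 u
          rw [LinearMap.smul_apply, ← map_smul, h2 x₀ u]
          simp [mul_comm, LinearMap.sum_apply]
        have h5 := congrArg (fun g : SmoothFun m M 𝕜 => g y) (congrArg φ h4)
        simp only [map_smul, map_sum, hsumR] at h5
        change (χ x₀ y * χ x₀ y) * φ η y = ∑ i, η (σ x₀ i) y * φ (θ x₀ i) y at h5
        rw [hy, one_mul, one_mul] at h5
        rw [h5]
        simp only [w, map_sum, map_smul, hsumR]
        exact Finset.sum_congr rfl fun i _ => mul_comm _ _
      have hw' : ∀ x₀ y, χ x₀ y = 1 → w y y = w x₀ y := fun x₀ y hy =>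
        hsep y _ _ fun η => by rw [hw η x₀ y hy, hw η y y (h1 y).self_of_nhds]
      let u : SmoothSec m F A :=
        ⟨fun y => w y y, fun x₀ => by
          refine ((w x₀).contMDiff x₀).congr_of_eventuallyEq ?_
          filter_upwards [h1 x₀] with y hy
          rw [hw' x₀ y hy]⟩
      refine ⟨u, ?_⟩
      ext η y
      rw [Dual.eval_apply, ← hw η y y (h1 y).self_of_nhds,
        hloc η y y u (h1 y).self_of_nhds, hloc η y y (w y) (h1 y).self_of_nhds]
      refine Finset.sum_congr rfl fun i _ => ?_
      rw [h3 y i u (w y) y rfl]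

/-- A form `α` on a bundle (given by its values on sections) vanishes at no point of `M`. -/
def NowhereVanishing {L : Type*} {k : ℕ} (α : (Fin k → L) → SmoothFun m M 𝕜) : Prop :=
  ∀ x : M, ∃ u : Fin k → L, α u x ≠ 0

end Geometry

end

/-! The top exterior powers of `A`, of its dual and of the cotangent bundle are line bundles, so
each Lie derivative of a nowhere vanishing section is a multiple of it: L_u V = c(u) V, L_θ Ω =
c'(θ) Ω, L_D s = dv(D) s. By duality of the volumes, L_u Ω = -c(u) Ω and L_θ V = -c'(θ) V
(`IsDualVolume.cochainLie_add`, from the product rule for determinants). The defining equations of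
the modular cocycles then read ⟨X₀, θ⟩ = c'(θ) + dv(ρ_*θ) and ⟨ξ₀, u⟩ = c(u) + dv(ρu).

The bialgebroid condition enters through functions. In degrees (0, 0) it makes {f, g} = ρ_*(df) g
antisymmetric, so that ρ(d_*f) = -ρ_*(df). In degrees (1, 0) it gives L_{df} u = [u, d_*f], hence
c'(df) = c(d_*f). Subtracting the two cocycle formulas at df and d_*f gives (ρ(X₀) - ρ_*(ξ₀)) f = 2
dv(ρ_*(df)), twice the modular vector field of the bracket {·, ·}. Its divergence vanishes
(`divergence_modular_eq_zero`): in coordinates x_i, with s = w dx₁ ∧ ⋯ ∧ dx_m, it is 2 w⁻¹ ∑ ∂_i ∂_j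
(w {x_i, x_j}), a symmetric operator contracted with an antisymmetric array. The Jacobi identity
plays no part here. This is assertion 4, dv(ρX₀) = dv(ρ_*ξ₀).

Computing ⟨ξ₀, X₀⟩ by both cocycle formulas now gives c(X₀) = c'(ξ₀), which is 1 and 2. For 3, Ω and
V have top degree, so Cartan's formula gives d ι_X Ω = L_X Ω (`LieAlgebroid.d_insertFirst_of_top`),
and both functions in 3 equal c(X₀) when the rank is positive.

Vector fields are derivations of the ring of functions, so coordinate frames for them are built from
bump functions and Hadamard's lemma. -/

noncomputable section

/-! ### Lie derivatives of forms and multivectors, and dual volumes -/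

section AlgebroidCalculus

variable {R : Type*} [CommRing R] [Algebra ℝ R]
variable {L : Type*} [AddCommGroup L] [Module R L]

/-- `δ` is a derivation of the module `L` over the derivation `D` of the ring `R`. -/
structure IsModuleDerivation (D : Derivation ℝ R R) (δ : L → L) : Prop where
  add : ∀ X Y, δ (X + Y) = δ X + δ Y
  smul : ∀ (f : R) X, δ (f • X) = D f • X + f • δ X

namespace IsModuleDerivation

variable {D : Derivation ℝ R R} {δ : L → L}

/-- The induced operator on alternating forms. -/
def altLie (hδ : IsModuleDerivation D δ) {k : ℕ} (α : L [⋀^Fin k]→ₗ[R] R) :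
    L [⋀^Fin k]→ₗ[R] R where
  toFun := cochainLie D δ α
  map_update_add' := by
    intro dec Y j a b
    obtain rfl : dec = instDecidableEqFin k := Subsingleton.elim _ _
    simp only [cochainLie, AlternatingMap.map_update_add, map_add]
    have h : ∀ i, α (Function.update (Function.update Y j (a + b)) i
          (δ (Function.update Y j (a + b) i))) =
        α (Function.update (Function.update Y j a) i (δ (Function.update Y j a i))) +
        α (Function.update (Function.update Y j b) i (δ (Function.update Y j b i))) := by
      intro i
      by_cases hij : i = j
      · subst hij
        simp [hδ.add]
      · simp only [Function.update_of_ne hij, Function.update_comm (Ne.symm hij),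
          AlternatingMap.map_update_add]
    simp only [h, Finset.sum_add_distrib]
    ring
  map_update_smul' := by
    intro dec Y j f a
    obtain rfl : dec = instDecidableEqFin k := Subsingleton.elim _ _
    simp only [cochainLie, AlternatingMap.map_update_smul, smul_eq_mul, Derivation.leibniz]
    -- The extra term `D f * α (…)`, arising only at `i = j`, cancels the one from the Leibniz rule
    -- for `D (f * α (…))`.
    have h : ∀ i, α (Function.update (Function.update Y j (f • a)) i
          (δ (Function.update Y j (f • a) i))) =
        (if i = j then D f * α (Function.update Y j a) else 0) +
        f * α (Function.update (Function.update Y j a) i (δ (Function.update Y j a i))) := by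
      intro i
      by_cases hij : i = j
      · subst hij
        simp [hδ.smul]
      · simp only [Function.update_of_ne hij, Function.update_comm (Ne.symm hij),
          AlternatingMap.map_update_smul, if_neg hij, smul_eq_mul, zero_add]
    simp only [h, Finset.sum_add_distrib, Finset.sum_ite_eq', Finset.mem_univ, if_true,
      ← Finset.mul_sum]
    ring
  map_eq_zero_of_eq' := by
    intro Y i j hY hij
    simp only [cochainLie, α.map_eq_zero_of_eq Y hY hij, map_zero, zero_sub, neg_eq_zero]
    -- The summands at `i` and `j` differ by a transposition and cancel; every other summand keeps
    -- the repeated argument.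
    rw [← Finset.add_sum_erase _ _ (Finset.mem_univ i),
      ← Finset.add_sum_erase _ _ (Finset.mem_erase.2 ⟨hij.symm, Finset.mem_univ j⟩), ← add_assoc]
    rw [Finset.sum_eq_zero, add_zero]
    · have : Function.update Y j (δ (Y j)) =
          Function.update Y i (δ (Y i)) ∘ Equiv.swap i j := by
        funext l
        by_cases hli : l = i
        · subst hli; simp [hij, hij.symm, hY]
        · by_cases hlj : l = j
          · subst hlj; simp [hY]
          · simp [Equiv.swap_apply_of_ne_of_ne hli hlj, hli, hlj]
      rw [this, α.map_swap _ hij, add_neg_cancel]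
    · intro l hl
      simp only [Finset.mem_erase, Finset.mem_univ, and_true] at hl
      refine α.map_eq_zero_of_eq _ ?_ hij
      rw [Function.update_of_ne hl.2.symm, Function.update_of_ne hl.1.symm, hY]

@[simp]
theorem coe_altLie (hδ : IsModuleDerivation D δ) {k : ℕ} (α : L [⋀^Fin k]→ₗ[R] R) :
    ⇑(hδ.altLie α) = cochainLie D δ α := rfl

end IsModuleDerivation

theorem isModuleDerivation_lie (D : Derivation ℝ R R) :
    IsModuleDerivation D (fun Y : Derivation ℝ R R => ⁅D, Y⁆) where
  add := lie_add D
  smul f Y := by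
    ext g
    simp only [Derivation.commutator_apply, Derivation.smul_apply, Derivation.add_apply,
      smul_eq_mul, Derivation.leibniz]
    ring

/-- Product rule for the determinant of a matrix over a ring with a derivation `D`. -/
theorem derivation_det {k : ℕ} (D : Derivation ℝ R R) (A N₁ N₂ : Matrix (Fin k) (Fin k) R)
    (h : ∀ i j, D (A i j) = N₁ i j + N₂ i j) :
    D A.det = ∑ i, (A.updateRow i (N₁ i)).det + ∑ j, (A.updateCol j fun i => N₂ i j).det := by
  have hprod : ∀ (t : Finset (Fin k)) (g : Fin k → R),
      D (∏ i ∈ t, g i) = ∑ j ∈ t, D (g j) * ∏ i ∈ t.erase j, g i := by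
    intro t g
    induction t using Finset.induction_on with
    | empty => simp
    | insert a t ha ih =>
      rw [Finset.prod_insert ha, Derivation.leibniz, ih, Finset.sum_insert ha,
        Finset.erase_insert ha, add_comm]
      simp only [smul_eq_mul, Finset.mul_sum]
      congr 1
      · ring
      · refine Finset.sum_congr rfl fun j hj => ?_
        have hne : a ≠ j := fun h => ha (h ▸ hj)
        rw [Finset.erase_insert_of_ne hne,
          Finset.prod_insert (fun h => ha (Finset.mem_of_mem_erase h))]
        ring
  have hrow : ∀ (σ : Equiv.Perm (Fin k)) (l : Fin k),
      ∏ i, A.updateRow (σ l) (N₁ (σ l)) (σ i) i =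
        N₁ (σ l) l * ∏ i ∈ Finset.univ.erase l, A (σ i) i := by
    intro σ l
    rw [← Finset.mul_prod_erase _ _ (Finset.mem_univ l), Matrix.updateRow_self]
    congr 1
    refine Finset.prod_congr rfl fun i hi => ?_
    rw [Matrix.updateRow_ne (fun h => Finset.ne_of_mem_erase hi (σ.injective h))]
  have hcol : ∀ (σ : Equiv.Perm (Fin k)) (l : Fin k),
      ∏ i, A.updateCol l (fun i => N₂ i l) (σ i) i =
        N₂ (σ l) l * ∏ i ∈ Finset.univ.erase l, A (σ i) i := by
    intro σ l
    rw [← Finset.mul_prod_erase _ _ (Finset.mem_univ l), Matrix.updateCol_self]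
    congr 1
    refine Finset.prod_congr rfl fun i hi => ?_
    rw [Matrix.updateCol_ne (Finset.ne_of_mem_erase hi)]
  simp only [Matrix.det_apply']
  rw [Finset.sum_comm, Finset.sum_comm (s := Finset.univ (α := Fin k)), ← Finset.sum_add_distrib,
    map_sum]
  refine Finset.sum_congr rfl fun σ _ => ?_
  have hs : D (((Equiv.Perm.sign σ : ℤ) : R)) = 0 := by
    rw [Derivation.map_intCast]
  -- For fixed `σ`, the sum over the modified row is reindexed by the column `l` in which `σ` meets
  -- that row, to match the sum over columns.
  rw [Derivation.leibniz, hs, smul_zero, add_zero, smul_eq_mul, hprod,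
    ← Equiv.sum_comp σ (fun i => ((Equiv.Perm.sign σ : ℤ) : R) *
      ∏ j, A.updateRow i (N₁ i) (σ j) j), Finset.mul_sum, ← Finset.sum_add_distrib]
  refine Finset.sum_congr rfl fun l _ => ?_
  rw [hrow, hcol, h]
  ring

/-- Operators on `L` and on its dual which are compatible with the pairing act in opposite ways on
a volume form and on its dual volume. -/
theorem IsDualVolume.cochainLie_add {n : ℕ} {Ω : L [⋀^Fin n]→ₗ[R] R}
    {V : Dual R L [⋀^Fin n]→ₗ[R] R} (hV : IsDualVolume Ω V) (D : Derivation ℝ R R) (δ : L → L)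
    (δ' : Dual R L → Dual R L) (h : ∀ (θ : Dual R L) u, D (θ u) = δ' θ u + θ (δ u))
    (u : Fin n → L) (θ : Fin n → Dual R L) :
    cochainLie D δ Ω u * V θ + Ω u * cochainLie D δ' V θ = 0 := by
  -- Differentiate det(θᵢ(uⱼ)) = Ω(u) V(θ): row variations give the action of `δ'` on `V`, column
  -- variations that of `δ` on `Ω`.
  have h1 := derivation_det D (Matrix.of fun i j => θ i (u j))
    (Matrix.of fun i j => δ' (θ i) (u j)) (Matrix.of fun i j => θ i (δ (u j)))
    (fun i j => h _ _)
  have hr : ∀ i, ((Matrix.of fun i j => θ i (u j)).updateRow i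
      ((Matrix.of fun i j => δ' (θ i) (u j)) i)).det =
      Ω u * V (Function.update θ i (δ' (θ i))) := by
    intro i
    rw [← hV]
    congr 1
    ext a b
    by_cases hab : a = i
    · subst hab; simp
    · simp [hab]
  have hc : ∀ j, ((Matrix.of fun i j => θ i (u j)).updateCol j
      (fun i => (Matrix.of fun i j => θ i (δ (u j))) i j)).det =
      Ω (Function.update u j (δ (u j))) * V θ := by
    intro j
    rw [← hV]
    congr 1
    ext a b
    by_cases hab : b = j
    · subst hab; simp
    · simp [hab]
  simp only [hr, hc, hV u θ, Derivation.leibniz, ← Finset.mul_sum, ← Finset.sum_mul,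
    smul_eq_mul] at h1
  simp only [cochainLie]
  linear_combination h1

namespace LieAlgebroid

variable (𝒜 : LieAlgebroid R L)

theorem bracket_swap (X Y : L) : 𝒜.bracket Y X = -𝒜.bracket X Y := by
  have h := 𝒜.bracket_self (X + Y)
  simp only [map_add, AddMonoidHom.add_apply, 𝒜.bracket_self] at h
  rw [zero_add, add_zero] at h
  exact eq_neg_of_add_eq_zero_left h

theorem isModuleDerivation_bracket (X : L) :
    IsModuleDerivation (𝒜.anchor X) (𝒜.bracket X) where
  add := map_add _
  smul f Y := 𝒜.leibniz X f Y

theorem isModuleDerivation_lieDual (X : L) :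
    IsModuleDerivation (𝒜.anchor X) (𝒜.lieDual X) where
  add θ η := by
    ext Y
    simp only [lieDual, LinearMap.coe_mk, AddHom.coe_mk, LinearMap.add_apply, map_add]
    ring
  smul f θ := by
    ext Y
    simp only [lieDual, LinearMap.coe_mk, AddHom.coe_mk, LinearMap.add_apply,
      LinearMap.smul_apply, smul_eq_mul, Derivation.leibniz]
    ring

theorem anchor_pairing (X : L) (θ : Dual R L) (u : L) :
    𝒜.anchor X (θ u) = 𝒜.lieDual X θ u + θ (𝒜.bracket X u) := by
  simp [lieDual]

end LieAlgebroid

theorem apply_lieBidual [IsReflexive R L] (𝒜' : LieAlgebroid R (Dual R L)) (θ η : Dual R L)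
    (u : L) : η (lieBidual 𝒜' θ u) = 𝒜'.anchor θ (η u) - 𝒜'.bracket θ η u := by
  have h : Dual.eval R L (lieBidual 𝒜' θ u) = 𝒜'.lieDual θ (Dual.eval R L u) :=
    (evalEquiv R L).apply_symm_apply _
  have := congrArg (fun φ => φ η) h
  simpa [LieAlgebroid.lieDual] using this

theorem isModuleDerivation_lieBidual [IsReflexive R L] (𝒜' : LieAlgebroid R (Dual R L))
    (θ : Dual R L) : IsModuleDerivation (𝒜'.anchor θ) (lieBidual 𝒜' θ) where
  add X Y := by
    have h := (𝒜'.isModuleDerivation_lieDual θ).add (Dual.eval R L X) (Dual.eval R L Y)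
    simp only [lieBidual, map_add, h]
  smul f X := by
    have h := (𝒜'.isModuleDerivation_lieDual θ).smul f (Dual.eval R L X)
    simp only [lieBidual, map_smul, h, map_add]
    congr 2
    exact (evalEquiv R L).symm_apply_apply X

/-- For a dual volume, `L_X Ω` and `L_X V` are opposite multiples. -/
theorem IsDualVolume.lieForm_add_lieVec {n : ℕ} {Ω : L [⋀^Fin n]→ₗ[R] R}
    {V : Dual R L [⋀^Fin n]→ₗ[R] R} (hV : IsDualVolume Ω V) (𝒜 : LieAlgebroid R L) (X : L)
    (u : Fin n → L) (θ : Fin n → Dual R L) :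
    𝒜.lieForm X Ω u * V θ + Ω u * 𝒜.lieVec X V θ = 0 :=
  hV.cochainLie_add _ _ _ (𝒜.anchor_pairing X) u θ

theorem IsDualVolume.lieCovec_add_lieForm [IsReflexive R L] {n : ℕ} {Ω : L [⋀^Fin n]→ₗ[R] R}
    {V : Dual R L [⋀^Fin n]→ₗ[R] R} (hV : IsDualVolume Ω V) (𝒜' : LieAlgebroid R (Dual R L))
    (θ : Dual R L) (u : Fin n → L) (η : Fin n → Dual R L) :
    lieCovec 𝒜' θ Ω u * V η + Ω u * 𝒜'.lieForm θ V η = 0 :=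
  hV.cochainLie_add _ _ _ (fun η u => by rw [apply_lieBidual]; ring) u η

end AlgebroidCalculus

/-! ### Cartan calculus for the Lie algebroid differential -/

section AlgebroidDifferential

variable {R : Type*} [CommRing R]
variable {L : Type*} [AddCommGroup L] [Module R L]

theorem Fin.removeNth_succ_cons {α : Type*} {k : ℕ} (i : Fin (k + 1)) (x : α)
    (Y : Fin (k + 1) → α) :
    i.succ.removeNth (Fin.cons x Y : Fin (k + 2) → α) = Fin.cons x (i.removeNth Y) := by
  funext j
  refine Fin.cases ?_ (fun j => ?_) j
  · simp [Fin.removeNth]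
  · simp [Fin.removeNth]

/-- Contraction of an alternating form with a section. -/
def altInsert (X : L) {k : ℕ} (α : L [⋀^Fin (k + 1)]→ₗ[R] R) : L [⋀^Fin k]→ₗ[R] R :=
  α.curryLeft X

theorem coe_altInsert (X : L) {k : ℕ} (α : L [⋀^Fin (k + 1)]→ₗ[R] R) :
    ⇑(altInsert X α) = insertFirst X α := rfl

/-- Moving the first argument to slot `j` takes `j` transpositions. This translates the signed sums
in the differential into the slotwise substitutions of the Lie derivative. -/
theorem neg_one_pow_mul_cons_removeNth {k : ℕ} (α : L [⋀^Fin (k + 1)]→ₗ[R] R)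
    (Z : L) (Y : Fin (k + 1) → L) (j : Fin (k + 1)) :
    (-1) ^ (j : ℕ) * α (Fin.cons Z (j.removeNth Y)) = α (Function.update Y j Z) := by
  have h := α.neg_one_pow_smul_map_insertNth j Z (j.removeNth Y)
  rw [Fin.insertNth_removeNth] at h
  change (-1) ^ (j : ℕ) * α (Matrix.vecCons Z (j.removeNth Y)) = _
  rw [← h]
  rcases Nat.even_or_odd (j : ℕ) with hj | hj <;> simp [hj.neg_one_pow]

theorem map_cons_cons_swap {k : ℕ} (α : L [⋀^Fin (k + 2)]→ₗ[R] R) (X Z : L) (W : Fin k → L) :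
    α (Fin.cons Z (Fin.cons X W)) = -α (Fin.cons X (Fin.cons Z W)) := by
  have h := neg_one_pow_mul_cons_removeNth α X (Fin.cons Z (Fin.cons X W)) (Fin.succ 0)
  rw [Fin.removeNth_succ_cons, Fin.removeNth_zero, Fin.tail_cons] at h
  rw [Function.update_eq_self_iff.2 (by simp)] at h
  rw [← h]
  simp

/-- A `k`-form valued additive map which is alternating in all arguments is a `(k+1)`-form. -/
theorem exists_alternating_of_cons {k : ℕ} (γ : L → L [⋀^Fin (k + 1)]→ₗ[R] R)
    (hadd : ∀ X X', γ (X + X') = γ X + γ X')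
    (hself : ∀ (X : L) (Y : Fin k → L), γ X (Fin.cons X Y) = 0) :
    ∃ β : L [⋀^Fin (k + 2)]→ₗ[R] R, ∀ (X : L) (Y : Fin (k + 1) → L), β (Fin.cons X Y) = γ X Y := by
  have hswap : ∀ (X Z : L) (Y : Fin k → L), γ X (Fin.cons Z Y) = -γ Z (Fin.cons X Y) := by
    intro X Z Y
    have h := hself (X + Z) Y
    have e : ∀ (g : L [⋀^Fin (k + 1)]→ₗ[R] R),
        g (Fin.cons (X + Z) Y) = g (Fin.cons X Y) + g (Fin.cons Z Y) := fun g => by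
      have := g.toMultilinearMap.cons_add Y X Z
      exact this
    rw [hadd, AlternatingMap.add_apply, e, e, hself, hself] at h
    linear_combination h
  -- Homogeneity in `X` comes for free: antisymmetry moves `X` into a slot of a form, which is
  -- already linear.
  have hsmul : ∀ (f : R) X, γ (f • X) = f • γ X := by
    intro f X
    ext Y
    rw [← Fin.cons_self_tail Y, hswap, AlternatingMap.smul_apply, hswap X]
    have := (γ (Y 0)).toMultilinearMap.cons_smul (Fin.tail Y) f X
    change γ (Y 0) _ = f • γ (Y 0) _ at this
    rw [this, smul_neg]
  have hmem : ∀ X Y j, Y j = X → γ X Y = 0 := by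
    intro X Y j h
    rw [← Function.update_eq_self j Y, ← neg_one_pow_mul_cons_removeNth, h, hself, mul_zero]
  let g : L →ₗ[R] MultilinearMap R (fun _ : Fin (k + 1) => L) R :=
    { toFun := fun X => (γ X).toMultilinearMap
      map_add' := fun X Z => by rw [hadd]; rfl
      map_smul' := fun f X => by rw [hsmul]; rfl }
  let G : MultilinearMap R (fun _ : Fin (k + 2) => L) R :=
    LinearMap.uncurryLeft (M := fun _ : Fin (k + 2) => L) g
  have hg : ∀ (X : L) (Y : Fin (k + 1) → L), G (Fin.cons X Y) = γ X Y := fun X Y => rfl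
  refine ⟨{ G with map_eq_zero_of_eq' := ?_ }, hg⟩
  intro Y i j hY hij
  change G Y = 0
  rw [← Fin.cons_self_tail Y, hg]
  rcases Fin.eq_zero_or_eq_succ i with rfl | ⟨i, rfl⟩
  · rcases Fin.eq_zero_or_eq_succ j with rfl | ⟨j, rfl⟩
    · exact absurd rfl hij
    · exact hmem _ _ j hY.symm
  · rcases Fin.eq_zero_or_eq_succ j with rfl | ⟨j, rfl⟩
    · exact hmem _ _ i hY
    · exact (γ (Y 0)).map_eq_zero_of_eq _ hY fun h => hij (congrArg Fin.succ h)

variable [Algebra ℝ R]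

namespace LieAlgebroid

variable (𝒜 : LieAlgebroid R L)

theorem d_add {k : ℕ} (α β : (Fin k → L) → R) : 𝒜.d (α + β) = 𝒜.d α + 𝒜.d β := by
  cases k with
  | zero => ext X; simp [d]
  | succ k =>
    ext X
    simp only [d, Pi.add_apply, map_add, mul_add, Finset.sum_add_distrib]
    ring

theorem d_zero {k : ℕ} : 𝒜.d (0 : (Fin k → L) → R) = 0 := by
  have h := 𝒜.d_add (0 : (Fin k → L) → R) 0
  rw [add_zero] at h
  exact left_eq_add.1 h

/-- Cartan's formula. -/
theorem insertFirst_d {k : ℕ} (α : L [⋀^Fin (k + 1)]→ₗ[R] R) (X : L) :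
    insertFirst X (𝒜.d α) = 𝒜.lieForm X α - 𝒜.d (insertFirst X α) := by
  ext Y
  have hfirst : ∑ i : Fin (k + 2), (-1) ^ (i : ℕ) *
      𝒜.anchor ((Fin.cons X Y : Fin (k + 2) → L) i)
        (α (i.removeNth (Fin.cons X Y : Fin (k + 2) → L))) =
      𝒜.anchor X (α Y) - ∑ i : Fin (k + 1), (-1) ^ (i : ℕ) *
        𝒜.anchor (Y i) (insertFirst X α (i.removeNth Y)) := by
    rw [Fin.sum_univ_succ]
    simp only [Fin.val_zero, pow_zero, one_mul, Fin.cons_zero, Fin.removeNth_zero, Fin.tail_cons,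
      Fin.val_succ, Fin.cons_succ, Fin.removeNth_succ_cons, insertFirst, sub_eq_add_neg,
      ← Finset.sum_neg_distrib]
    congr 1
    refine Finset.sum_congr rfl fun i _ => ?_
    ring
  -- The bracket terms pairing `X` with `Y j` are split off; they make up the sum in the Lie
  -- derivative. The rest belong to `d (ι_X α)`.
  have hsecond : ∀ j : Fin (k + 1), ∑ i : Fin (k + 1) with i.castSucc < j.succ,
        (-1) ^ ((i : ℕ) + (j.succ : ℕ)) * α (Fin.cons (𝒜.bracket
          ((Fin.cons X Y : Fin (k + 2) → L) i.castSucc) ((Fin.cons X Y : Fin (k + 2) → L) j.succ))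
          (i.removeNth (j.succ.removeNth (Fin.cons X Y : Fin (k + 2) → L)))) =
      -α (Function.update Y j (𝒜.bracket X (Y j))) +
      ∑ i : Fin k with i.succ.castSucc < j.succ, (-1) ^ ((i.succ : ℕ) + (j.succ : ℕ)) *
          α (Fin.cons (𝒜.bracket
          ((Fin.cons X Y : Fin (k + 2) → L) i.succ.castSucc) (Y j))
          (i.succ.removeNth (j.succ.removeNth (Fin.cons X Y : Fin (k + 2) → L)))) := by
    intro j
    rw [Finset.sum_filter, Fin.sum_univ_succ, ← Finset.sum_filter]
    congr 1
    rw [if_pos (by simp), ← neg_one_pow_mul_cons_removeNth, Fin.removeNth_zero,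
      Fin.removeNth_succ_cons, Fin.tail_cons]
    simp [pow_succ]
  cases k with
  | zero =>
    change (∑ i : Fin 2, _) + _ = 𝒜.anchor X (α Y) - _ - _
    rw [hfirst, Fin.sum_univ_succ (n := 1)]
    simp only [hsecond]
    simp only [Nat.reduceAdd, d, insertFirst]
    simp [Subsingleton.elim (Fin.tail Y) Fin.elim0]
    ring
  | succ k =>
    change (∑ i : Fin (k + 3), _) + ∑ j : Fin (k + 3), _ =
      𝒜.anchor X (α Y) - _ - ((∑ i : Fin (k + 2), _) + ∑ j : Fin (k + 2), _)
    rw [hfirst, Fin.sum_univ_succ (n := k + 2)]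
    simp only [hsecond, Finset.sum_add_distrib]
    have h0 : ∑ i : Fin (k + 2) with i.castSucc < 0, (-1) ^ ((i : ℕ) + ((0 : Fin (k + 3)) : ℕ)) *
        α (Fin.cons (𝒜.bracket
          ((Fin.cons X Y : Fin (k + 3) → L) i.castSucc) ((Fin.cons X Y : Fin (k + 3) → L) 0))
          (i.removeNth (Fin.removeNth 0 (Fin.cons X Y : Fin (k + 3) → L)))) = 0 := by
      simp
    have h2 : ∑ j : Fin (k + 2), ∑ i : Fin (k + 1) with i.succ.castSucc < j.succ,
          (-1) ^ ((i.succ : ℕ) + (j.succ : ℕ)) * α (Fin.cons (𝒜.bracket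
          ((Fin.cons X Y : Fin (k + 3) → L) i.succ.castSucc) (Y j))
          (i.succ.removeNth (j.succ.removeNth (Fin.cons X Y : Fin (k + 3) → L)))) =
        -∑ j : Fin (k + 2), ∑ i : Fin (k + 1) with i.castSucc < j, (-1) ^ ((i : ℕ) + (j : ℕ)) *
          insertFirst X α (Fin.cons (𝒜.bracket (Y i.castSucc) (Y j))
            (i.removeNth (j.removeNth Y))) := by
      rw [← Finset.sum_neg_distrib]
      refine Finset.sum_congr rfl fun j _ => ?_
      rw [← Finset.sum_neg_distrib]
      refine Finset.sum_congr (by ext i; simp [Fin.lt_def]) fun i _ => ?_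
      rw [Fin.removeNth_succ_cons, Fin.removeNth_succ_cons, ← Fin.succ_castSucc, Fin.cons_succ]
      have hsw : α (Fin.cons (𝒜.bracket (Y i.castSucc) (Y j))
          (Fin.cons X (i.removeNth (j.removeNth Y)))) = -insertFirst X α (Fin.cons
            (𝒜.bracket (Y i.castSucc) (Y j)) (i.removeNth (j.removeNth Y))) :=
        map_cons_cons_swap α _ _ _
      rw [hsw]
      simp only [Fin.val_succ]
      ring
    rw [h0, h2]
    simp only [Finset.sum_neg_distrib]
    ring

theorem lieForm_cons_self {k : ℕ} (α : L [⋀^Fin (k + 2)]→ₗ[R] R) (X : L) (Y : Fin (k + 1) → L) :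
    𝒜.lieForm X α (Fin.cons X Y) = 𝒜.lieForm X (insertFirst X α) Y := by
  simp only [lieForm, cochainLie, insertFirst]
  rw [Fin.sum_univ_succ]
  simp only [Fin.cons_zero, 𝒜.bracket_self, Fin.cons_succ, Fin.cons_update]
  rw [α.map_coord_zero (0 : Fin (k + 2)) (Function.update_self _ _ _), zero_add]

/-- The differential of an alternating form is an alternating form. -/
theorem exists_alternating_eq_d {k : ℕ} (α : L [⋀^Fin k]→ₗ[R] R) :
    ∃ β : L [⋀^Fin (k + 1)]→ₗ[R] R, ⇑β = 𝒜.d α := by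
  induction k with
  | zero =>
    refine ⟨AlternatingMap.ofSubsingleton R L R (0 : Fin 1) (𝒜.dFun (α Fin.elim0)), ?_⟩
    rfl
  | succ k ih =>
    -- By Cartan's formula, `d α` with first argument `X` is L_X α - d ι_X α, which is alternating
    -- in the remaining arguments by the induction hypothesis. It remains to treat the first slot.
    choose β hβ using fun X => ih (altInsert X α)
    let γ : L → L [⋀^Fin (k + 1)]→ₗ[R] R := fun X =>
      (𝒜.isModuleDerivation_bracket X).altLie α - β X
    have hγ : ∀ (X : L) (Y : Fin (k + 1) → L), γ X Y = 𝒜.d α (Fin.cons X Y) := by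
      intro X Y
      have h := congrFun (𝒜.insertFirst_d α X) Y
      rw [insertFirst] at h
      rw [h, ← coe_altInsert, ← hβ]
      rfl
    suffices h : _ ∧ _ by
      obtain ⟨b, hb⟩ := exists_alternating_of_cons γ h.1 h.2
      refine ⟨b, funext fun Y => ?_⟩
      rw [← Fin.cons_self_tail Y, hb, hγ]
    constructor
    · intro X X'
      have h1 : β (X + X') = β X + β X' := by
        apply DFunLike.coe_injective
        have e : ⇑(β X + β X') = ⇑(β X) + ⇑(β X') := rfl
        have e' : ⇑(altInsert (X + X') α) = ⇑(altInsert X α) + ⇑(altInsert X' α) := by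
          ext Y
          simp [altInsert]
        rw [e, hβ, hβ, hβ, ← d_add, e']
      have h2 : (𝒜.isModuleDerivation_bracket (X + X')).altLie α =
          (𝒜.isModuleDerivation_bracket X).altLie α +
          (𝒜.isModuleDerivation_bracket X').altLie α := by
        ext Y
        simp only [IsModuleDerivation.coe_altLie, AlternatingMap.add_apply, cochainLie, map_add,
          AddMonoidHom.add_apply, AlternatingMap.map_update_add, Finset.sum_add_distrib,
          Derivation.add_apply]
        ring
      simp only [γ, h1, h2]
      abel
    · intro X Y
      have h : γ X (Fin.cons X Y) = 𝒜.lieForm X α (Fin.cons X Y) -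
          𝒜.d (insertFirst X α) (Fin.cons X Y) := by
        rw [← coe_altInsert, ← hβ]
        rfl
      rw [h]
      -- For a 1-form both terms equal ρ(X)(α(X)). In higher degree, Cartan's formula for ι_X α
      -- together with ι_X ι_X α = 0 gives ι_X d ι_X α = L_X ι_X α, and the two terms cancel.
      cases k with
      | zero =>
        have hY : (Fin.cons X Y : Fin 1 → L) = fun _ => X := by
          ext i; rw [Fin.eq_zero i, Fin.cons_zero]
        have hY' : (Fin.cons X Fin.elim0 : Fin 1 → L) = fun _ => X := by
          ext i; rw [Fin.eq_zero i, Fin.cons_zero]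
        rw [hY]
        simp [lieForm, cochainLie, d, 𝒜.bracket_self, insertFirst, hY']
      | succ k =>
        have h3 := congrFun (𝒜.insertFirst_d (altInsert X α) X) Y
        have h4 : insertFirst X (altInsert X α) = (0 : (Fin k → L) → R) := by
          ext W
          exact α.map_eq_zero_of_eq _ (i := 0) (j := 1) rfl (by simp)
        rw [h4, d_zero, sub_zero, coe_altInsert] at h3
        rw [lieForm_cons_self, ← h3]
        exact sub_self _

/-- For a form `α` of top degree, `d ι_X α = L_X α`. -/
theorem d_insertFirst_of_top {k : ℕ} (htop : ∀ β : L [⋀^Fin (k + 2)]→ₗ[R] R, β = 0)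
    (α : L [⋀^Fin (k + 1)]→ₗ[R] R) (X : L) : 𝒜.d (insertFirst X α) = 𝒜.lieForm X α := by
  obtain ⟨β, hβ⟩ := 𝒜.exists_alternating_eq_d α
  have h := 𝒜.insertFirst_d α X
  rw [← hβ, htop β] at h
  exact (sub_eq_zero.1 h.symm).symm

end LieAlgebroid

end AlgebroidDifferential

/-! ### Top-degree forms and smooth quotients via local frames -/

section LocalFrames

/-- Pulled back along the map from `Fin n → R` to `L` given by `σ`, `α` is a multiple of the
determinant; the coordinate vectors `θ i (u j)` map to `χ • u j`, whence the power of `χ`. -/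
theorem AlternatingMap.pow_mul_eq_det_mul {R L : Type*} [CommRing R] [AddCommGroup L] [Module R L]
    {n : ℕ} (α : L [⋀^Fin n]→ₗ[R] R) {χ : R} {σ : Fin n → L} {θ : Fin n → Dual R L}
    (h : ∀ u, χ • u = ∑ i, θ i u • σ i) (u : Fin n → L) :
    χ ^ n * α u = (Matrix.of fun i j => θ i (u j)).det * α σ := by
  have h1 := (α.compLinearMap (Fintype.linearCombination R σ)).eq_smul_basis_det
    (Pi.basisFun R (Fin n))
  have h2 := congrArg (fun f => f fun j i => θ i (u j)) h1
  have h3 : ∀ j, Fintype.linearCombination R σ (fun i => θ i (u j)) = χ • u j := fun j => by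
    rw [h, Fintype.linearCombination_apply]
  simp only [AlternatingMap.compLinearMap_apply, h3, AlternatingMap.smul_apply,
    Pi.basisFun_det_apply, Pi.basisFun_apply, Fintype.linearCombination_apply_single, one_smul, smul_eq_mul] at h2
  rw [α.map_smul_univ (fun _ => χ) u, Finset.prod_const, Finset.card_univ, Fintype.card_fin,
    smul_eq_mul] at h2
  rw [h2, ← Matrix.det_transpose, mul_comm]
  rfl

theorem AlternatingMap.pow_mul_eq_zero {R L : Type*} [CommRing R] [AddCommGroup L] [Module R L]
    {n : ℕ} (β : L [⋀^Fin (n + 1)]→ₗ[R] R) {χ : R} {σ : Fin n → L} {θ : Fin n → Dual R L}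
    (h : ∀ u, χ • u = ∑ i, θ i u • σ i) (u : Fin (n + 1) → L) : χ ^ (n + 1) * β u = 0 := by
  have h1 : β.compLinearMap (Fintype.linearCombination R σ) = 0 :=
    Basis.ext_alternating (Pi.basisFun R (Fin n)) fun v hv =>
      absurd (Fintype.card_le_of_injective v hv) (by simp)
  have h2 := congrArg (fun f => f fun j i => θ i (u j)) h1
  have h3 : ∀ j, Fintype.linearCombination R σ (fun i => θ i (u j)) = χ • u j := fun j => by
    rw [h, Fintype.linearCombination_apply]
  simp only [AlternatingMap.compLinearMap_apply, h3, AlternatingMap.zero_apply] at h2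
  rw [β.map_smul_univ (fun _ => χ) u, Finset.prod_const, Finset.card_univ, Fintype.card_fin,
    smul_eq_mul] at h2
  exact h2

variable {m : ℕ} {M : Type*} [TopologicalSpace M] [ChartedSpace (EuclideanSpace ℝ (Fin m)) M]
  {𝕜 : Type*} [RCLike 𝕜]

namespace SmoothFun

theorem mul_apply (f g : SmoothFun m M 𝕜) (x : M) : (f * g) x = f x * g x := rfl

theorem pow_apply (f : SmoothFun m M 𝕜) (k : ℕ) (x : M) : (f ^ k) x = f x ^ k :=
  map_pow (ContMDiffMap.evalRingHom x : SmoothFun m M 𝕜 →+* 𝕜) f k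

theorem sum_apply {ι : Type*} (t : Finset ι) (f : ι → SmoothFun m M 𝕜) (x : M) :
    (∑ i ∈ t, f i) x = ∑ i ∈ t, f i x :=
  map_sum (ContMDiffMap.evalRingHom x : SmoothFun m M 𝕜 →+* 𝕜) f t

/-- Proportional families of functions, one of them without common zeros, have a smooth
quotient. -/
theorem exists_eq_mul {ι : Type*} {a b : ι → SmoothFun m M 𝕜}
    (h : ∀ i j, a i * b j = a j * b i) (hb : ∀ x, ∃ i, b i x ≠ 0) :
    ∃ g : SmoothFun m M 𝕜, ∀ i, a i = g * b i := by
  choose i hi using hb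
  have hx : ∀ x j l, a j x * b l x = a l x * b j x := fun x j l =>
    congrArg (fun f : SmoothFun m M 𝕜 => f x) (h j l)
  refine ⟨⟨fun x => a (i x) x / b (i x) x, fun x => ?_⟩, fun j => ?_⟩
  · have hs : ContMDiffAt (𝓡 m) 𝓘(ℝ, 𝕜) ∞ (fun y => (b (i x) y)⁻¹) x :=
      (contDiffAt_inv ℝ (hi x)).contMDiffAt.comp x (b (i x)).contMDiff.contMDiffAt
    refine ((a (i x)).contMDiff.contMDiffAt.mul hs).congr_of_eventuallyEq ?_
    -- The index chosen at `y` may jump, but proportionality lets the fixed index `i x` replace it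
    -- near `x`.
    filter_upwards [(b (i x)).contMDiff.continuous.continuousAt.eventually_ne (hi x)] with y hy
    change a (i y) y / b (i y) y = a (i x) y * (b (i x) y)⁻¹
    rw [← div_eq_mul_inv, div_eq_div_iff (hi y) hy]
    exact hx y _ _
  · ext x
    change a j x = a (i x) x / b (i x) x * b j x
    have := hi x
    field_simp
    exact hx x _ _

theorem eq_of_mul_eq_mul {ι : Type*} {f g : SmoothFun m M 𝕜} {b : ι → SmoothFun m M 𝕜}
    (hb : ∀ x, ∃ i, b i x ≠ 0) (h : ∀ i, f * b i = g * b i) : f = g := by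
  ext x
  obtain ⟨i, hi⟩ := hb x
  exact mul_right_cancel₀ hi (congrArg (fun f : SmoothFun m M 𝕜 => f x) (h i))

end SmoothFun

variable (m M 𝕜) in
/-- The module `L` over the smooth functions has local frames of `n` elements: it is, locally, the
module of sections of a bundle of rank `n`. -/
def HasLocalFrames (L : Type*) [AddCommGroup L] [Module (SmoothFun m M 𝕜) L] (n : ℕ) : Prop :=
  ∀ x : M, ∃ (χ : SmoothFun m M 𝕜) (σ : Fin n → L) (θ : Fin n → Dual (SmoothFun m M 𝕜) L),
    χ x = 1 ∧ ∀ u, χ • u = ∑ i, θ i u • σ i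

namespace HasLocalFrames

variable {L : Type*} [AddCommGroup L] [Module (SmoothFun m M 𝕜) L] {n : ℕ}

theorem dual (hL : HasLocalFrames m M 𝕜 L n) :
    HasLocalFrames m M 𝕜 (Dual (SmoothFun m M 𝕜) L) n := by
  intro x
  obtain ⟨χ, σ, θ, hχ, h⟩ := hL x
  refine ⟨χ, θ, fun i => Dual.eval _ _ (σ i), hχ, fun η => ?_⟩
  ext1 u
  rw [LinearMap.smul_apply, ← map_smul, h u]
  simp [mul_comm, LinearMap.sum_apply]

/-- At each point a top form is its value on the frame times a determinant depending only on the
arguments, so any two are proportional. -/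
theorem mul_comm_of_top (hL : HasLocalFrames m M 𝕜 L n)
    (α β : L [⋀^Fin n]→ₗ[SmoothFun m M 𝕜] SmoothFun m M 𝕜) (u v : Fin n → L) :
    α u * β v = α v * β u := by
  ext x
  obtain ⟨χ, σ, θ, hχ, h⟩ := hL x
  have key : ∀ (γ : L [⋀^Fin n]→ₗ[SmoothFun m M 𝕜] SmoothFun m M 𝕜) w,
      γ w x = (Matrix.of fun i j => θ i (w j)).det x * γ σ x := fun γ w => by
    have := congrArg (fun f : SmoothFun m M 𝕜 => f x) (γ.pow_mul_eq_det_mul h w)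
    simpa only [SmoothFun.mul_apply, SmoothFun.pow_apply, hχ, one_pow, one_mul] using this
  rw [SmoothFun.mul_apply, SmoothFun.mul_apply, key α u, key β v, key α v, key β u]
  ring

theorem eq_zero_of_succ (hL : HasLocalFrames m M 𝕜 L n)
    (β : L [⋀^Fin (n + 1)]→ₗ[SmoothFun m M 𝕜] SmoothFun m M 𝕜) : β = 0 := by
  ext u x
  obtain ⟨χ, σ, θ, hχ, h⟩ := hL x
  have := congrArg (fun f : SmoothFun m M 𝕜 => f x) (β.pow_mul_eq_zero h u)
  simp only [SmoothFun.mul_apply, SmoothFun.pow_apply, hχ, one_pow, one_mul] at this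
  exact this

theorem exists_eq_mul (hL : HasLocalFrames m M 𝕜 L n)
    (α β : L [⋀^Fin n]→ₗ[SmoothFun m M 𝕜] SmoothFun m M 𝕜) (hβ : NowhereVanishing β) :
    ∃ g : SmoothFun m M 𝕜, ∀ u, α u = g * β u :=
  SmoothFun.exists_eq_mul (hL.mul_comm_of_top α β) hβ

/-- On the dual frame `θ`, Ω(u) = det(θᵢ(uⱼ)) Ω(σ) = Ω(u) V(θ) Ω(σ) at `x`, so V(θ) cannot vanish
there. -/
theorem nowhereVanishing_dual (hL : HasLocalFrames m M 𝕜 L n)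
    {Ω : L [⋀^Fin n]→ₗ[SmoothFun m M 𝕜] SmoothFun m M 𝕜} (hΩ : NowhereVanishing Ω)
    {V : Dual (SmoothFun m M 𝕜) L [⋀^Fin n]→ₗ[SmoothFun m M 𝕜] SmoothFun m M 𝕜}
    (hV : IsDualVolume Ω V) : NowhereVanishing V := by
  intro x
  obtain ⟨χ, σ, θ, hχ, h⟩ := hL x
  obtain ⟨u, hu⟩ := hΩ x
  refine ⟨θ, fun h0 => hu ?_⟩
  have := congrArg (fun f : SmoothFun m M 𝕜 => f x) (Ω.pow_mul_eq_det_mul h u)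
  simpa only [SmoothFun.mul_apply, SmoothFun.pow_apply, hχ, one_pow, one_mul, hV u θ, h0, mul_zero,
    zero_mul] using this

end HasLocalFrames

theorem hasLocalFrames_smoothSec
    {F : Type*} [NormedAddCommGroup F] [NormedSpace ℝ F] [NormedSpace 𝕜 F] [IsScalarTower ℝ 𝕜 F]
    {A : M → Type*} [TopologicalSpace (TotalSpace F A)] [∀ x, TopologicalSpace (A x)]
    [∀ x, AddCommGroup (A x)] [∀ x, Module ℝ (A x)] [∀ x, Module 𝕜 (A x)]
    [FiberBundle F A] [VectorBundle ℝ F A] [VectorBundle 𝕜 F A]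
    [FiniteDimensional 𝕜 F] [T2Space M] [IsManifold (𝓡 m) ∞ M]
    [ContMDiffVectorBundle ∞ F A (𝓡 m)] :
    HasLocalFrames m M 𝕜 (SmoothSec m F A) (finrank 𝕜 F) := by
  intro x
  obtain ⟨χ, σ, θ, h1, h2, -⟩ := exists_cutoff_frame (m := m) (𝕜 := 𝕜) (F := F) (A := A) x
  -- The square appears because the frame and the dual frame each carry a cutoff.
  refine ⟨χ * χ, σ, θ, ?_, h2⟩
  rw [SmoothFun.mul_apply, h1.self_of_nhds, one_mul]

end LocalFrames

/-! ### Smooth dependence of integrals on parameters and Hadamard's lemma -/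

section HadamardLemma

variable {m : ℕ}

theorem hasFDerivAt_intervalIntegral_of_contDiff {G : Type*} [NormedAddCommGroup G]
    [NormedSpace ℝ G] [CompleteSpace G] {f : EuclideanSpace ℝ (Fin m) × ℝ → G}
    (hf : ContDiff ℝ ∞ f) (x : EuclideanSpace ℝ (Fin m)) :
    HasFDerivAt (fun x => ∫ t in (0 : ℝ)..1, f (x, t))
      (∫ t in (0 : ℝ)..1, (fderiv ℝ f (x, t)).comp (ContinuousLinearMap.inl ℝ _ ℝ)) x := by
  have hc : Continuous fun p => (fderiv ℝ f p).comp
      (ContinuousLinearMap.inl ℝ (EuclideanSpace ℝ (Fin m)) ℝ) :=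
    (hf.continuous_fderiv (by simp)).clm_comp continuous_const
  obtain ⟨C, hC⟩ := ((isCompact_closedBall x 1).prod
    (isCompact_uIcc (a := (0 : ℝ)) (b := 1))).exists_bound_of_continuousOn hc.continuousOn
  refine (intervalIntegral.hasFDerivAt_integral_of_dominated_of_fderiv_le (bound := fun _ => C)
    (F' := fun x t => (fderiv ℝ f (x, t)).comp (ContinuousLinearMap.inl ℝ _ ℝ))
    (Metric.closedBall_mem_nhds x one_pos) ?_ ?_ ?_ ?_ ?_ ?_)
  · exact Filter.Eventually.of_forall fun y =>
      (hf.continuous.comp (by fun_prop)).aestronglyMeasurable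
  · exact (hf.continuous.comp (by fun_prop)).intervalIntegrable _ _
  · exact (hc.comp (by fun_prop : Continuous fun t : ℝ => (x, t))).aestronglyMeasurable
  · exact Filter.Eventually.of_forall fun t ht y hy =>
      hC (y, t) ⟨hy, Set.uIoc_subset_uIcc ht⟩
  · exact intervalIntegrable_const
  · refine Filter.Eventually.of_forall fun t _ y _ => ?_
    have h1 := (hf.differentiable (by simp) (y, t)).hasFDerivAt
    exact h1.comp y (hasFDerivAt_prodMk_left y t)

/-- The derivative is again an integral of a smooth integrand, with values in a space of linear
maps; hence the induction varies `G`. -/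
theorem contDiff_nat_intervalIntegral (n : ℕ) {G : Type*} [NormedAddCommGroup G]
    [NormedSpace ℝ G] [CompleteSpace G] {f : EuclideanSpace ℝ (Fin m) × ℝ → G}
    (hf : ContDiff ℝ ∞ f) : ContDiff ℝ n (fun x => ∫ t in (0 : ℝ)..1, f (x, t)) := by
  induction n generalizing G with
  | zero =>
    rw [Nat.cast_zero, contDiff_zero]
    exact continuous_iff_continuousAt.2 fun x =>
      (hasFDerivAt_intervalIntegral_of_contDiff hf x).continuousAt
  | succ n ih =>
    rw [Nat.cast_succ, contDiff_succ_iff_fderiv]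
    refine ⟨fun x => (hasFDerivAt_intervalIntegral_of_contDiff hf x).differentiableAt, by simp, ?_⟩
    have h2 : fderiv ℝ (fun x => ∫ t in (0 : ℝ)..1, f (x, t)) = fun x =>
        ∫ t in (0 : ℝ)..1, (fderiv ℝ f (x, t)).comp (ContinuousLinearMap.inl ℝ _ ℝ) :=
      funext fun x => (hasFDerivAt_intervalIntegral_of_contDiff hf x).fderiv
    rw [h2]
    exact ih (f := fun p => (fderiv ℝ f p).comp (ContinuousLinearMap.inl ℝ _ ℝ))
      ((hf.fderiv_right (by simp)).clm_comp contDiff_const)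

theorem contDiff_intervalIntegral {G : Type*} [NormedAddCommGroup G]
    [NormedSpace ℝ G] [CompleteSpace G] {f : EuclideanSpace ℝ (Fin m) × ℝ → G}
    (hf : ContDiff ℝ ∞ f) : ContDiff ℝ ∞ (fun x => ∫ t in (0 : ℝ)..1, f (x, t)) :=
  contDiff_infty.2 fun n => contDiff_nat_intervalIntegral n hf

/-- Hadamard's lemma. -/
theorem exists_hadamard {G : Type*} [NormedAddCommGroup G] [NormedSpace ℝ G] [CompleteSpace G]
    {f : EuclideanSpace ℝ (Fin m) → G} (hf : ContDiff ℝ ∞ f) (p : EuclideanSpace ℝ (Fin m)) :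
    ∃ g : Fin m → EuclideanSpace ℝ (Fin m) → G, (∀ i, ContDiff ℝ ∞ (g i)) ∧
      (∀ i, g i p = fderiv ℝ f p (EuclideanSpace.single i 1)) ∧
      ∀ z, f z = f p + ∑ i, (z i - p i) • g i z := by
  have hs : ∀ i, ContDiff ℝ ∞ fun q : EuclideanSpace ℝ (Fin m) × ℝ =>
      fderiv ℝ f (p + q.2 • (q.1 - p)) (EuclideanSpace.single i 1) := fun i =>
    ((hf.fderiv_right (m := ∞) (by simp)).comp
      (by fun_prop : ContDiff ℝ ∞ fun q : EuclideanSpace ℝ (Fin m) × ℝ =>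
        p + q.2 • (q.1 - p))).clm_apply contDiff_const
  refine ⟨fun i z => ∫ t in (0 : ℝ)..1, fderiv ℝ f (p + t • (z - p)) (EuclideanSpace.single i 1),
    fun i => contDiff_intervalIntegral (hs i), fun i => by simp, fun z => ?_⟩
  -- Integrate the derivative of `f` along the segment from `p` to `z`.
  have hd : ∀ t ∈ Set.uIcc (0 : ℝ) 1, HasDerivAt (fun t : ℝ => f (p + t • (z - p)))
      (∑ i, (z i - p i) • fderiv ℝ f (p + t • (z - p)) (EuclideanSpace.single i 1)) t := by
    intro t _
    have h1 : HasDerivAt (fun t : ℝ => p + t • (z - p)) (z - p) t := by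
      simpa using ((hasDerivAt_id t).smul_const (z - p)).const_add p
    have h2 := (hf.differentiable (by simp) (p + t • (z - p))).hasFDerivAt.comp_hasDerivAt t h1
    have h3 : z - p = ∑ i, (z i - p i) • EuclideanSpace.single i (1 : ℝ) := by
      ext j
      simp [Finset.sum_apply, Pi.single_apply]
    have h4 : fderiv ℝ f (p + t • (z - p)) (z - p) =
        ∑ i, (z i - p i) • fderiv ℝ f (p + t • (z - p)) (EuclideanSpace.single i 1) := by
      conv_lhs => arg 2; rw [h3]
      rw [map_sum]
      simp only [map_smul]
    rwa [h4] at h2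
  have hi : ∀ i, Continuous fun t : ℝ =>
      (z i - p i) • fderiv ℝ f (p + t • (z - p)) (EuclideanSpace.single i 1) := fun i =>
    ((hs i).continuous.comp (by fun_prop : Continuous fun t : ℝ => (z, t))).const_smul _
  have h5 := intervalIntegral.integral_eq_sub_of_hasDerivAt hd
    ((continuous_finsetSum _ fun i _ => hi i).intervalIntegrable _ _)
  rw [intervalIntegral.integral_finsetSum fun i _ => (hi i).intervalIntegrable _ _] at h5
  simp only [intervalIntegral.integral_smul, one_smul, zero_smul, add_zero, add_sub_cancel] at h5
  rw [h5, add_sub_cancel]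

end HadamardLemma

/-! ### Derivations of smooth functions in local coordinates -/

section VectorFields

variable {m : ℕ} {M : Type*} [TopologicalSpace M] [ChartedSpace (EuclideanSpace ℝ (Fin m)) M]
  {𝕜 : Type*} [RCLike 𝕜]

variable (m M) in
/-- The constant function with value `c`. -/
def SmoothFun.const (c : 𝕜) : SmoothFun m M 𝕜 := ⟨fun _ => c, contMDiff_const⟩

/-- Real linearity covers real constants; differentiating I² = -1 gives 2 I D(I) = 0 in the complex
case. -/
theorem Derivation.map_const (D : Derivation ℝ (SmoothFun m M 𝕜) (SmoothFun m M 𝕜)) (c : 𝕜) :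
    D (SmoothFun.const m M c) = 0 := by
  have hreal : ∀ r : ℝ, D (SmoothFun.const m M (r : 𝕜)) = 0 := by
    intro r
    have h : SmoothFun.const m M (r : 𝕜) = algebraMap ℝ (SmoothFun m M 𝕜) r := by
      rw [Algebra.algebraMap_eq_smul_one]
      ext x
      change (r : 𝕜) = r • (1 : 𝕜)
      rw [RCLike.real_smul_eq_coe_mul, mul_one]
    rw [h, Derivation.map_algebraMap]
  have hI : D (SmoothFun.const m M (RCLike.I : 𝕜)) = 0 := by
    rcases eq_or_ne (RCLike.I : 𝕜) 0 with h0 | h0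
    · have := hreal 0
      rwa [RCLike.ofReal_zero, ← h0] at this
    · have h1 : SmoothFun.const m M (RCLike.I : 𝕜) * SmoothFun.const m M (RCLike.I : 𝕜) =
          SmoothFun.const m M ((-1 : ℝ) : 𝕜) := by
        ext x
        change (RCLike.I : 𝕜) * RCLike.I = ((-1 : ℝ) : 𝕜)
        rw [RCLike.I_mul_I_of_nonzero h0]; simp
      have h2 := congrArg D h1
      rw [hreal, Derivation.leibniz, smul_eq_mul] at h2
      ext x
      have h3 : (RCLike.I : 𝕜) * D (SmoothFun.const m M RCLike.I) x +
          RCLike.I * D (SmoothFun.const m M RCLike.I) x = 0 :=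
        congrArg (fun f : SmoothFun m M 𝕜 => f x) h2
      rw [← two_mul, mul_eq_zero, mul_eq_zero] at h3
      simpa [h0] using h3
  have h : SmoothFun.const m M c = SmoothFun.const m M ((RCLike.re c : ℝ) : 𝕜) +
      SmoothFun.const m M ((RCLike.im c : ℝ) : 𝕜) * SmoothFun.const m M RCLike.I := by
    ext x
    exact (RCLike.re_add_im c).symm
  rw [h, map_add, Derivation.leibniz, hreal, hreal, hI]
  simp

namespace SmoothBumpFunction

theorem contDiffOn_comp_symm [IsManifold (𝓡 m) ∞ M] (x₀ : M) (h : SmoothFun m M 𝕜) :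
    ContDiffOn ℝ ∞ (h ∘ (extChartAt (𝓡 m) x₀).symm) (extChartAt (𝓡 m) x₀).target := by
  rw [← contMDiffOn_iff_contDiffOn]
  exact h.contMDiff.comp_contMDiffOn (contMDiffOn_extChartAt_symm x₀)

theorem eventually_symm {x₀ y : M} (hy : y ∈ (extChartAt (𝓡 m) x₀).source) {p : M → Prop}
    (hp : ∀ᶠ y in 𝓝 y, p y) :
    ∀ᶠ z in 𝓝 (extChartAt (𝓡 m) x₀ y), z ∈ (extChartAt (𝓡 m) x₀).target ∧
      p ((extChartAt (𝓡 m) x₀).symm z) := by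
  have hc := continuousAt_extChartAt_symm' (I := 𝓡 m) hy
  rw [ContinuousAt, (extChartAt (𝓡 m) x₀).left_inv hy] at hc
  have ht : ∀ᶠ z in 𝓝 (extChartAt (𝓡 m) x₀ y), z ∈ (extChartAt (𝓡 m) x₀).target :=
    (isOpen_extChartAt_target x₀).mem_nhds ((extChartAt (𝓡 m) x₀).map_source hy)
  exact ht.and (hc.eventually hp)

theorem eq_zero_of_notMem_source {x₀ y : M} (b : SmoothBumpFunction (𝓡 m) x₀)
    (hy : y ∉ (extChartAt (𝓡 m) x₀).source) : b y = 0 := by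
  by_contra h
  exact hy (by rw [extChartAt_source]; exact b.support_subset_source h)

theorem contDiffAt_comp_symm [IsManifold (𝓡 m) ∞ M] {x₀ : M} (h : SmoothFun m M 𝕜) {y : M}
    (hy : y ∈ (extChartAt (𝓡 m) x₀).source) :
    ContDiffAt ℝ ∞ (h ∘ (extChartAt (𝓡 m) x₀).symm) (extChartAt (𝓡 m) x₀ y) :=
  (contDiffOn_comp_symm x₀ h).contDiffAt ((isOpen_extChartAt_target x₀).mem_nhds
    ((extChartAt (𝓡 m) x₀).map_source hy))

theorem contDiffOn_partial [IsManifold (𝓡 m) ∞ M] (x₀ : M) (h : SmoothFun m M 𝕜) (i : Fin m) :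
    ContDiffOn ℝ ∞ (fun z => fderiv ℝ (h ∘ (extChartAt (𝓡 m) x₀).symm) z
      (EuclideanSpace.single i 1)) (extChartAt (𝓡 m) x₀).target :=
  ((contDiffOn_comp_symm x₀ h).fderiv_of_isOpen (isOpen_extChartAt_target x₀)
    (by simp)).clm_apply contDiffOn_const

/-- Hadamard's lemma integrates along segments, so it needs a function smooth on the whole model
space; the bump supplies one with the same germ. -/
theorem exists_contDiff_eventuallyEq [IsManifold (𝓡 m) ∞ M] {x₀ : M}
    (b : SmoothBumpFunction (𝓡 m) x₀) (h : SmoothFun m M 𝕜) {y : M}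
    (hy : y ∈ (extChartAt (𝓡 m) x₀).source) (hb : ∀ᶠ y in 𝓝 y, b y = 1) :
    ∃ f : EuclideanSpace ℝ (Fin m) → 𝕜, ContDiff ℝ ∞ f ∧
      f =ᶠ[𝓝 (extChartAt (𝓡 m) x₀ y)] h ∘ (extChartAt (𝓡 m) x₀).symm := by
  refine ⟨fun z => b.toContDiffBump z • (h ∘ (extChartAt (𝓡 m) x₀).symm) z, ?_, ?_⟩
  · refine contMDiff_iff_contDiff.1 (contMDiff_of_tsupport fun z hz => ?_)
    have hz' : z ∈ (extChartAt (𝓡 m) x₀).target := by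
      apply b.closedBall_subset
      have := tsupport_smul_subset_left _ _ hz
      rw [ContDiffBump.tsupport_eq] at this
      exact ⟨this, by simp⟩
    exact (b.toContDiffBump.contDiffAt.smul ((contDiffOn_comp_symm x₀ h).contDiffAt
      ((isOpen_extChartAt_target x₀).mem_nhds hz'))).contMDiffAt
  · filter_upwards [eventually_symm hy hb] with z hz
    have := b.eqOn_source (by
      rw [← extChartAt_source (𝓡 m)]; exact (extChartAt (𝓡 m) x₀).map_target hz.1)
    rw [hz.2, Function.comp_apply, (extChartAt (𝓡 m) x₀).right_inv hz.1] at this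
    simp only [← this, one_smul]

end SmoothBumpFunction

variable [T2Space M] [IsManifold (𝓡 m) ∞ M]

/-- A smooth function with support in a neighbourhood `s` of `x` which is one near `x`. -/
theorem SmoothFun.exists_cutoff (𝕜 : Type*) [RCLike 𝕜] {x : M} {s : Set M} (hs : s ∈ 𝓝 x) :
    ∃ χ : SmoothFun m M 𝕜, (∀ᶠ y in 𝓝 x, χ y = 1) ∧ ∀ y ∉ s, χ y = 0 := by
  obtain ⟨f, hf, -⟩ := (SmoothBumpFunction.nhds_basis_support (I := 𝓡 m) hs).mem_iff.1 hs
  refine ⟨⟨fun x => ((f x : ℝ) : 𝕜),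
    (RCLike.ofRealCLM (K := 𝕜)).contDiff.contMDiff.comp f.contMDiff⟩, ?_, fun y hy => ?_⟩
  · filter_upwards [f.eventuallyEq_one] with y hy
    change ((f y : ℝ) : 𝕜) = 1
    rw [hy]; simp
  · have h0 : f y = 0 := image_eq_zero_of_notMem_tsupport fun h => hy (hf h)
    change ((f y : ℝ) : 𝕜) = 0
    rw [h0]; simp

/-- Derivations of the ring of smooth functions are local operators. -/
theorem Derivation.apply_eq_of_eventuallyEq
    (D : Derivation ℝ (SmoothFun m M 𝕜) (SmoothFun m M 𝕜)) {f g : SmoothFun m M 𝕜} {x : M}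
    (h : ∀ᶠ y in 𝓝 x, f y = g y) : D f x = D g x := by
  obtain ⟨χ, h1, h0⟩ := SmoothFun.exists_cutoff (m := m) 𝕜 h
  -- `χ` vanishes wherever `f` and `g` differ; applying `D` to this product and evaluating at `x`
  -- gives the claim.
  have hk : χ * (f - g) = 0 := by
    ext y
    change χ y * (f y - g y) = 0
    by_cases hy : f y = g y
    · rw [hy, sub_self, mul_zero]
    · rw [h0 y hy, zero_mul]
  have h2 := congrArg (fun k : SmoothFun m M 𝕜 => k x) (congrArg D hk)
  rw [Derivation.leibniz, map_zero, map_sub] at h2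
  have h3 : χ x * (D f x - D g x) + (f x - g x) * D χ x = 0 := h2
  rw [h1.self_of_nhds, h.self_of_nhds, sub_self, zero_mul, add_zero, one_mul] at h3
  exact sub_eq_zero.1 h3

theorem Derivation.eventually_apply_eq
    (D : Derivation ℝ (SmoothFun m M 𝕜) (SmoothFun m M 𝕜)) {f g : SmoothFun m M 𝕜} {x : M}
    (h : ∀ᶠ y in 𝓝 x, f y = g y) : ∀ᶠ y in 𝓝 x, D f y = D g y :=
  h.eventually_nhds.mono fun _ hy => D.apply_eq_of_eventuallyEq hy

namespace SmoothBumpFunction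

variable {x₀ : M} (b : SmoothBumpFunction (𝓡 m) x₀)

/-- A function on the model space, transported to the manifold and cut off. -/
def pullback {g : EuclideanSpace ℝ (Fin m) → 𝕜}
    (hg : ContDiffOn ℝ ∞ g (extChartAt (𝓡 m) x₀).target) : SmoothFun m M 𝕜 :=
  ⟨fun y => b y • g (extChartAt (𝓡 m) x₀ y), b.contMDiff_smul <|
    hg.contMDiffOn.comp contMDiffOn_extChartAt fun y hy =>
      (extChartAt (𝓡 m) x₀).map_source (by rwa [extChartAt_source])⟩

theorem pullback_apply {g : EuclideanSpace ℝ (Fin m) → 𝕜}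
    (hg : ContDiffOn ℝ ∞ g (extChartAt (𝓡 m) x₀).target) (y : M) :
    b.pullback hg y = b y • g (extChartAt (𝓡 m) x₀ y) := rfl

theorem pullback_comp_symm {g : EuclideanSpace ℝ (Fin m) → 𝕜}
    (hg : ContDiffOn ℝ ∞ g (extChartAt (𝓡 m) x₀).target) {y : M}
    (hy : y ∈ (extChartAt (𝓡 m) x₀).source) (hb : ∀ᶠ y in 𝓝 y, b y = 1) :
    b.pullback hg ∘ (extChartAt (𝓡 m) x₀).symm =ᶠ[𝓝 (extChartAt (𝓡 m) x₀ y)] g := by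
  filter_upwards [eventually_symm hy hb] with z hz
  rw [Function.comp_apply, pullback_apply, hz.2, one_smul, (extChartAt (𝓡 m) x₀).right_inv hz.1]

/-- The coordinate vector fields, cut off. -/
def coordField (𝕜 : Type*) [RCLike 𝕜] (i : Fin m) :
    Derivation ℝ (SmoothFun m M 𝕜) (SmoothFun m M 𝕜) :=
  Derivation.mk'
    { toFun := fun h => b.pullback (contDiffOn_partial x₀ h i)
      map_add' := fun h k => by
        ext y
        change b y • (_ : 𝕜) = b y • (_ : 𝕜) + b y • (_ : 𝕜)
        by_cases hy : y ∈ (extChartAt (𝓡 m) x₀).source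
        · have e := fderiv_add ((contDiffAt_comp_symm h hy).differentiableAt (by simp))
            ((contDiffAt_comp_symm k hy).differentiableAt (by simp))
          rw [← smul_add]
          exact congrArg (fun l => b y • l (EuclideanSpace.single i 1)) e
        · simp [b.eq_zero_of_notMem_source hy]
      map_smul' := fun c h => by
        ext y
        change b y • (_ : 𝕜) = c • (b y • (_ : 𝕜))
        by_cases hy : y ∈ (extChartAt (𝓡 m) x₀).source
        · have e := fderiv_const_smul ((contDiffAt_comp_symm h hy).differentiableAt (by simp)) c
          rw [smul_comm c]
          exact congrArg (fun l => b y • l (EuclideanSpace.single i 1)) e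
        · simp [b.eq_zero_of_notMem_source hy] }
    fun h k => by
      ext y
      change b y • (_ : 𝕜) = h y * (b y • (_ : 𝕜)) + k y * (b y • (_ : 𝕜))
      by_cases hy : y ∈ (extChartAt (𝓡 m) x₀).source
      · have e := fderiv_mul ((contDiffAt_comp_symm h hy).differentiableAt (by simp))
          ((contDiffAt_comp_symm k hy).differentiableAt (by simp))
        simp only [Function.comp_apply, (extChartAt (𝓡 m) x₀).left_inv hy] at e
        rw [mul_smul_comm, mul_smul_comm, ← smul_add]
        congr 1
        exact congrArg (fun l => l (EuclideanSpace.single i 1)) e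
      · simp [b.eq_zero_of_notMem_source hy]

theorem coordField_apply (i : Fin m) (h : SmoothFun m M 𝕜) :
    b.coordField 𝕜 i h = b.pullback (contDiffOn_partial x₀ h i) := rfl

theorem coordField_apply_of_eq_one (i : Fin m) (h : SmoothFun m M 𝕜) {y : M} (hb : b y = 1) :
    b.coordField 𝕜 i h y = fderiv ℝ (h ∘ (extChartAt (𝓡 m) x₀).symm) (extChartAt (𝓡 m) x₀ y)
      (EuclideanSpace.single i 1) := by
  rw [coordField_apply, pullback_apply, hb, one_smul]

theorem contDiff_coord (i : Fin m) :
    ContDiff ℝ ∞ fun z : EuclideanSpace ℝ (Fin m) => ((z i : ℝ) : 𝕜) :=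
  (RCLike.ofRealCLM (K := 𝕜)).contDiff.comp (by fun_prop)

/-- The coordinate functions, cut off. -/
def coordFun (𝕜 : Type*) [RCLike 𝕜] (i : Fin m) : SmoothFun m M 𝕜 :=
  b.pullback (contDiff_coord (𝕜 := 𝕜) i).contDiffOn

theorem coordField_coordFun (i j : Fin m) {y : M} (hy : y ∈ (extChartAt (𝓡 m) x₀).source)
    (hb : ∀ᶠ y in 𝓝 y, b y = 1) :
    b.coordField 𝕜 i (b.coordFun 𝕜 j) y = if i = j then 1 else 0 := by
  rw [coordField_apply_of_eq_one _ _ _ hb.self_of_nhds, coordFun,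
    (b.pullback_comp_symm _ hy hb).fderiv_eq]
  have h : HasFDerivAt (fun z : EuclideanSpace ℝ (Fin m) => ((z j : ℝ) : 𝕜))
      ((RCLike.ofRealCLM (K := 𝕜)).comp (EuclideanSpace.proj j)) (extChartAt (𝓡 m) x₀ y) :=
    ((RCLike.ofRealCLM (K := 𝕜)).comp (EuclideanSpace.proj j)).hasFDerivAt
  rw [h.fderiv]
  by_cases hij : i = j
  · subst hij; simp
  · simp [hij, Ne.symm hij]

theorem coordField_comm (i j : Fin m) (h : SmoothFun m M 𝕜) {y : M}
    (hy : y ∈ (extChartAt (𝓡 m) x₀).source) (hb : ∀ᶠ y in 𝓝 y, b y = 1) :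
    b.coordField 𝕜 i (b.coordField 𝕜 j h) y = b.coordField 𝕜 j (b.coordField 𝕜 i h) y := by
  have hs : ContDiffAt ℝ ∞ (fderiv ℝ (h ∘ (extChartAt (𝓡 m) x₀).symm))
      (extChartAt (𝓡 m) x₀ y) := (contDiffAt_comp_symm h hy).fderiv_right (by simp)
  have key : ∀ i j, b.coordField 𝕜 i (b.coordField 𝕜 j h) y =
      fderiv ℝ (fderiv ℝ (h ∘ (extChartAt (𝓡 m) x₀).symm)) (extChartAt (𝓡 m) x₀ y)
        (EuclideanSpace.single i 1) (EuclideanSpace.single j 1) := by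
    intro i j
    rw [coordField_apply_of_eq_one _ _ _ hb.self_of_nhds, coordField_apply,
      (b.pullback_comp_symm _ hy hb).fderiv_eq,
      fderiv_clm_apply (hs.differentiableAt (by simp)) (by fun_prop)]
    simp
  rw [key, key]
  exact ((contDiffAt_comp_symm h hy).isSymmSndFDerivAt
    (by simpa using WithTop.coe_le_coe.2 (le_top (a := (2 : ℕ∞))))) _ _

/-- Near `y`, Hadamard's lemma writes `h` as a constant plus ∑ (xᵢ - xᵢ(y)) Gᵢ with Gᵢ(y) = ∂ᵢh(y).
Apply `D` and evaluate at `y`. -/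
theorem derivation_apply_eq_sum (D : Derivation ℝ (SmoothFun m M 𝕜) (SmoothFun m M 𝕜))
    (h : SmoothFun m M 𝕜) {y : M} (hy : y ∈ (extChartAt (𝓡 m) x₀).source)
    (hb : ∀ᶠ y in 𝓝 y, b y = 1) :
    D h y = ∑ i, D (b.coordFun 𝕜 i) y * b.coordField 𝕜 i h y := by
  obtain ⟨f, hf, hfe⟩ := b.exists_contDiff_eventuallyEq h hy hb
  obtain ⟨g, hg, hgp, hfg⟩ := exists_hadamard hf (extChartAt (𝓡 m) x₀ y)
  let G : Fin m → SmoothFun m M 𝕜 := fun i => b.pullback (hg i).contDiffOn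
  have hG : ∀ i, G i y = b.coordField 𝕜 i h y := fun i => by
    rw [coordField_apply_of_eq_one _ _ _ hb.self_of_nhds, pullback_apply, hb.self_of_nhds,
      one_smul, hgp, hfe.fderiv_eq]
  have hloc : ∀ᶠ y' in 𝓝 y, h y' = (SmoothFun.const m M (h y) +
      ∑ i, (b.coordFun 𝕜 i - SmoothFun.const m M (b.coordFun 𝕜 i y)) * G i) y' := by
    have hc := (continuousAt_extChartAt' (I := 𝓡 m) hy).eventually hfe
    filter_upwards [hc, hb, (isOpen_extChartAt_source x₀).mem_nhds hy] with y' h1 h2 h3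
    have e1 : h y' = f (extChartAt (𝓡 m) x₀ y') := by
      rw [h1, Function.comp_apply, (extChartAt (𝓡 m) x₀).left_inv h3]
    have e2 : h y = f (extChartAt (𝓡 m) x₀ y) := by
      rw [hfe.self_of_nhds, Function.comp_apply, (extChartAt (𝓡 m) x₀).left_inv hy]
    change h y' = h y + (∑ i, (b.coordFun 𝕜 i - SmoothFun.const m M (b.coordFun 𝕜 i y)) * G i :
      SmoothFun m M 𝕜) y'
    rw [e1, e2, hfg, SmoothFun.sum_apply]
    congr 1
    refine Finset.sum_congr rfl fun i _ => ?_
    change _ = (b y' • (_ : 𝕜) - b y • (_ : 𝕜)) * (b y' • (_ : 𝕜))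
    rw [h2, hb.self_of_nhds, one_smul, one_smul, one_smul, RCLike.real_smul_eq_coe_mul]
    simp
  rw [D.apply_eq_of_eventuallyEq hloc, map_add, map_sum, Derivation.map_const, zero_add,
    SmoothFun.sum_apply]
  refine Finset.sum_congr rfl fun i _ => ?_
  rw [Derivation.leibniz, map_sub, Derivation.map_const, sub_zero, ← hG]
  change (b.coordFun 𝕜 i y - b.coordFun 𝕜 i y) * D (G i) y + G i y * D (b.coordFun 𝕜 i) y = _
  ring

end SmoothBumpFunction

/-- Local coordinates `X i` and the corresponding coordinate vector fields `E i`. -/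
theorem exists_coordinates (𝕜 : Type*) [RCLike 𝕜] (x₀ : M) :
    ∃ (X : Fin m → SmoothFun m M 𝕜)
      (E : Fin m → Derivation ℝ (SmoothFun m M 𝕜) (SmoothFun m M 𝕜)) (χ : SmoothFun m M 𝕜),
      (∀ᶠ y in 𝓝 x₀, χ y = 1) ∧
      (∀ D : Derivation ℝ (SmoothFun m M 𝕜) (SmoothFun m M 𝕜), χ • D = ∑ i, (χ * D (X i)) • E i) ∧
      (∀ i j, ∀ᶠ y in 𝓝 x₀, E i (X j) y = if i = j then 1 else 0) ∧
      (∀ i j h, ∀ᶠ y in 𝓝 x₀, E i (E j h) y = E j (E i h) y) := by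
  let b : SmoothBumpFunction (𝓡 m) x₀ := Classical.arbitrary _
  -- The coordinate identities at `y` need `b = 1` near `y`. The second cutoff `χ` vanishes off the
  -- set of such points, making the expansion of derivations global.
  have hU : ∀ᶠ y in 𝓝 x₀, y ∈ (extChartAt (𝓡 m) x₀).source ∧ ∀ᶠ y in 𝓝 y, b y = 1 :=
    Filter.Eventually.and (extChartAt_source_mem_nhds (I := 𝓡 m) x₀)
      b.eventuallyEq_one.eventually_nhds
  obtain ⟨χ, h1, h0⟩ := SmoothFun.exists_cutoff (m := m) 𝕜 hU
  refine ⟨b.coordFun 𝕜, b.coordField 𝕜, χ, h1, fun D => ?_, fun i j => ?_, fun i j h => ?_⟩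
  · ext h y
    have e : (∑ i, (χ * D (b.coordFun 𝕜 i)) • b.coordField 𝕜 i) h =
        ∑ i, (χ * D (b.coordFun 𝕜 i)) * b.coordField 𝕜 i h := by
      exact (congrFun (map_sum (Derivation.coeFnAddMonoidHom (R := ℝ)
        (A := SmoothFun m M 𝕜) (M := SmoothFun m M 𝕜)) _ _) h).trans (Finset.sum_apply _ _ _)
    rw [e, SmoothFun.sum_apply]
    change χ y * D h y = ∑ i, χ y * D (b.coordFun 𝕜 i) y * b.coordField 𝕜 i h y
    by_cases hy : y ∈ {y | y ∈ (extChartAt (𝓡 m) x₀).source ∧ ∀ᶠ y in 𝓝 y, b y = 1}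
    · rw [b.derivation_apply_eq_sum D h hy.1 hy.2, Finset.mul_sum]
      simp only [mul_assoc]
    · simp [h0 y hy]
  · filter_upwards [hU] with y hy
    exact b.coordField_coordFun i j hy.1 hy.2
  · filter_upwards [hU] with y hy
    exact b.coordField_comm i j h hy.1 hy.2

end VectorFields

/-! ### Divergence with respect to a volume form -/

section Divergence

variable {m : ℕ} {M : Type*} [TopologicalSpace M] [ChartedSpace (EuclideanSpace ℝ (Fin m)) M]
  {𝕜 : Type*} [RCLike 𝕜] [T2Space M] [IsManifold (𝓡 m) ∞ M]

/-- The functional `D ↦ χ * D f` on derivations. -/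
def evalDual {R : Type*} [CommRing R] [Algebra ℝ R] (χ f : R) : Dual R (Derivation ℝ R R) where
  toFun D := χ * D f
  map_add' D D' := by simp [mul_add]
  map_smul' g D := by simp; ring

theorem hasLocalFrames_derivation : HasLocalFrames m M 𝕜
    (Derivation ℝ (SmoothFun m M 𝕜) (SmoothFun m M 𝕜)) m := by
  intro x
  obtain ⟨X, E, χ, h1, h2, -⟩ := exists_coordinates (m := m) 𝕜 x
  exact ⟨χ, E, fun i => evalDual χ (X i), h1.self_of_nhds, h2⟩

/-- The divergence in local coordinates: if `L_D s = g s` then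
`g s(E) = ∑ᵢ Eᵢ (s(E) Dⁱ)`. -/
theorem eventually_divergence_eq
    {s : Derivation ℝ (SmoothFun m M 𝕜) (SmoothFun m M 𝕜) [⋀^Fin m]→ₗ[SmoothFun m M 𝕜]
      SmoothFun m M 𝕜}
    {x₀ : M} {X : Fin m → SmoothFun m M 𝕜}
    {E : Fin m → Derivation ℝ (SmoothFun m M 𝕜) (SmoothFun m M 𝕜)} {χ : SmoothFun m M 𝕜}
    (hχ : ∀ᶠ y in 𝓝 x₀, χ y = 1)
    (hD : ∀ D : Derivation ℝ (SmoothFun m M 𝕜) (SmoothFun m M 𝕜),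
      χ • D = ∑ i, (χ * D (X i)) • E i)
    (hE : ∀ i j, ∀ᶠ y in 𝓝 x₀, E i (X j) y = if i = j then 1 else 0)
    {D : Derivation ℝ (SmoothFun m M 𝕜) (SmoothFun m M 𝕜)} {g : SmoothFun m M 𝕜}
    (hg : ∀ Y, vectorFieldLie D s Y = g * s Y) :
    ∀ᶠ y in 𝓝 x₀, (g * s E) y = (∑ i, E i (s E * D (X i))) y := by
  -- Expanding `W` in the frame, all components but the `i`-th repeat an argument of `s`.
  have hup : ∀ i (W : Derivation ℝ (SmoothFun m M 𝕜) (SmoothFun m M 𝕜)),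
      χ * s (Function.update E i W) = χ * (W (X i) * s E) := by
    intro i W
    have h := s.map_update_smul E i χ W
    rw [hD W, AlternatingMap.map_update_sum, smul_eq_mul] at h
    rw [← h, Finset.sum_eq_single i]
    · rw [AlternatingMap.map_update_smul, Function.update_eq_self, smul_eq_mul, mul_assoc]
    · intro k _ hk
      rw [AlternatingMap.map_update_smul, s.map_update_self E hk.symm, smul_zero]
    · simp
  -- Thus [D, Eᵢ](xᵢ) reduces to -Eᵢ(D xᵢ), the divergence term.
  have hconst : ∀ i, ∀ᶠ y in 𝓝 x₀, D (E i (X i)) y = 0 := by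
    intro i
    have h : ∀ᶠ y in 𝓝 x₀, E i (X i) y = SmoothFun.const m M (1 : 𝕜) y := by
      filter_upwards [hE i i] with y hy
      rw [hy, if_pos rfl]; rfl
    filter_upwards [D.eventually_apply_eq h] with y hy
    rw [hy, Derivation.map_const]; rfl
  filter_upwards [hχ, Filter.eventually_all.2 hconst] with y hχy hcy
  have h1 := congrArg (fun f : SmoothFun m M 𝕜 => (χ * f) y) (hg E)
  simp only [vectorFieldLie, cochainLie] at h1
  rw [mul_sub, Finset.mul_sum] at h1
  simp only [hup] at h1
  have h2 : (χ * D (s E)) y = (∑ i, χ * (D (X i) * E i (s E))) y := by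
    have h := congrArg (fun W : Derivation ℝ (SmoothFun m M 𝕜) (SmoothFun m M 𝕜) => W (s E) y)
      (hD D)
    have e : (∑ i, (χ * D (X i)) • E i) (s E) = ∑ i, χ * D (X i) * E i (s E) :=
      (congrFun (map_sum (Derivation.coeFnAddMonoidHom (R := ℝ)
        (A := SmoothFun m M 𝕜) (M := SmoothFun m M 𝕜)) _ _) (s E)).trans (Finset.sum_apply _ _ _)
    simp only [e, mul_assoc] at h
    exact h
  rw [SmoothFun.mul_apply χ, hχy, one_mul] at h1
  rw [← h1]
  change (χ * D (s E)) y - _ = _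
  rw [h2, SmoothFun.sum_apply, SmoothFun.sum_apply, SmoothFun.sum_apply, ← Finset.sum_sub_distrib]
  refine Finset.sum_congr rfl fun i _ => ?_
  rw [Derivation.commutator_apply, Derivation.leibniz]
  change χ y * (D (X i) y * E i (s E) y) - χ y * ((D (E i (X i)) y - E i (D (X i)) y) * s E y) =
    s E y * E i (D (X i)) y + D (X i) y * E i (s E) y
  rw [hχy, hcy i]
  ring

/-- Let `f ↦ P f` be an antisymmetric biderivation. The vector field
`f ↦ 2 div (P f)` has divergence zero. -/
theorem divergence_modular_eq_zero
    {s : Derivation ℝ (SmoothFun m M 𝕜) (SmoothFun m M 𝕜) [⋀^Fin m]→ₗ[SmoothFun m M 𝕜]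
      SmoothFun m M 𝕜} (hs : NowhereVanishing s)
    {P : SmoothFun m M 𝕜 → Derivation ℝ (SmoothFun m M 𝕜) (SmoothFun m M 𝕜)}
    (hP : ∀ f g, P f g = -P g f) {dv : SmoothFun m M 𝕜 → SmoothFun m M 𝕜}
    (hdv : ∀ f Y, vectorFieldLie (P f) s Y = dv f * s Y)
    {Z : Derivation ℝ (SmoothFun m M 𝕜) (SmoothFun m M 𝕜)} (hZ : ∀ f, Z f = 2 * dv f)
    {g : SmoothFun m M 𝕜} (hg : ∀ Y, vectorFieldLie Z s Y = g * s Y) : g = 0 := by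
  ext x₀
  obtain ⟨X, E, χ, hχ, hD, hE, hcomm⟩ := exists_coordinates (m := m) 𝕜 x₀
  have h0 : s E x₀ ≠ 0 := by
    obtain ⟨Y, hY⟩ := hs x₀
    intro h
    refine hY ?_
    have := congrArg (fun f : SmoothFun m M 𝕜 => f x₀)
      (s.pow_mul_eq_det_mul (θ := fun i => evalDual χ (X i)) hD Y)
    simpa only [SmoothFun.mul_apply, SmoothFun.pow_apply, hχ.self_of_nhds, one_pow, one_mul, h,
      mul_zero] using this
  have h1 := (eventually_divergence_eq hχ hD hE hg).self_of_nhds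
  -- The divergence formula for `P (X i)` is used on a neighbourhood of `x₀`, since `E i` is then
  -- applied to it.
  have h2 : ∀ i, E i (s E * Z (X i)) x₀ =
      2 * ∑ j, E i (E j (s E * P (X i) (X j))) x₀ := by
    intro i
    have e : ∀ᶠ y in 𝓝 x₀, (s E * Z (X i)) y =
        (∑ j, (E j (s E * P (X i) (X j)) + E j (s E * P (X i) (X j)))) y := by
      filter_upwards [eventually_divergence_eq hχ hD hE (hdv (X i))] with y hy
      rw [Finset.sum_add_distrib]
      change s E y * Z (X i) y = (∑ j, E j (s E * P (X i) (X j))) y +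
        (∑ j, E j (s E * P (X i) (X j))) y
      rw [← hy, hZ, two_mul]
      change s E y * (dv (X i) y + dv (X i) y) = dv (X i) y * s E y + dv (X i) y * s E y
      ring
    rw [(E i).apply_eq_of_eventuallyEq e, map_sum, SmoothFun.sum_apply, Finset.mul_sum]
    refine Finset.sum_congr rfl fun j _ => ?_
    rw [map_add, two_mul]
    rfl
  have h3 : ∀ i j, E i (E j (s E * P (X i) (X j))) x₀ =
      -E j (E i (s E * P (X j) (X i))) x₀ := by
    intro i j
    rw [(hcomm i j _).self_of_nhds, hP, mul_neg, map_neg, map_neg]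
    rfl
  have h4 : ∑ i, ∑ j, E i (E j (s E * P (X i) (X j))) x₀ = 0 := by
    have h5 : ∑ i, ∑ j, E i (E j (s E * P (X i) (X j))) x₀ =
        -∑ i, ∑ j, E i (E j (s E * P (X i) (X j))) x₀ := by
      conv_lhs => rw [Finset.sum_comm]
      simp only [← Finset.sum_neg_distrib]
      exact Finset.sum_congr rfl fun j _ => Finset.sum_congr rfl fun i _ => h3 i j
    exact self_eq_neg.1 h5
  rw [SmoothFun.sum_apply] at h1
  simp only [h2, ← Finset.mul_sum, h4, mul_zero] at h1
  exact (mul_eq_zero.1 h1).resolve_right h0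

end Divergence

/-! ### Consequences of the bialgebroid condition on functions -/

section Bialgebroid

variable {R : Type*} [CommRing R] [Algebra ℝ R]
variable {L : Type*} [AddCommGroup L] [Module R L]

theorem LieAlgebroid.d_cons_const (𝒜 : LieAlgebroid R L) (α : (Fin 1 → L) → R) (X Y : L) :
    𝒜.d α (Fin.cons X fun _ => Y) = 𝒜.anchor X (α fun _ => Y) - 𝒜.anchor Y (α fun _ => X) -
      α fun _ => 𝒜.bracket X Y := by
  have h0 : (0 : Fin 2).removeNth (Fin.cons X fun _ => Y : Fin 2 → L) = fun _ => Y := rfl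
  have h1 : (1 : Fin 2).removeNth (Fin.cons X fun _ => Y : Fin 2 → L) = fun _ => X := by
    funext i; rw [Fin.eq_zero i]; rfl
  have h2 : ∀ Z W, (Fin.cons Z W : Fin 1 → L) = fun _ => Z := fun Z W => by
    funext i; rw [Fin.eq_zero i]; rfl
  have h3 : ({i : Fin 1 | i.castSucc < (1 : Fin 2)} : Finset (Fin 1)) = {0} := rfl
  have h4 : ({i : Fin 1 | i.castSucc < (0 : Fin 2)} : Finset (Fin 1)) = ∅ := rfl
  change ∑ i : Fin 2, (-1) ^ (i : ℕ) * 𝒜.anchor ((Fin.cons X fun _ => Y : Fin 2 → L) i)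
        (α (i.removeNth (Fin.cons X fun _ => Y : Fin 2 → L))) +
      ∑ j : Fin 2, ∑ i : Fin 1 with i.castSucc < j, (-1) ^ ((i : ℕ) + (j : ℕ)) *
        α (Fin.cons (𝒜.bracket ((Fin.cons X fun _ => Y : Fin 2 → L) i.castSucc)
          ((Fin.cons X fun _ => Y : Fin 2 → L) j)) _) = _
  simp only [Fin.sum_univ_two, h0, h1, h2, h3, h4, Finset.sum_singleton, Finset.sum_empty,
    Fin.val_zero, Fin.val_one, Fin.cons_zero, Fin.castSucc_zero, Fin.cons_one]
  ring

theorem vectorFieldLie_sub (D D' : Derivation ℝ R R) {k : ℕ}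
    (s : Derivation ℝ R R [⋀^Fin k]→ₗ[R] R) (Y : Fin k → Derivation ℝ R R) :
    vectorFieldLie (D - D') s Y = vectorFieldLie D s Y - vectorFieldLie D' s Y := by
  simp only [vectorFieldLie, cochainLie, sub_lie, AlternatingMap.map_update_sub,
    Finset.sum_sub_distrib, Derivation.sub_apply]
  ring

theorem vectorFieldLie_neg (D : Derivation ℝ R R) {k : ℕ}
    (s : Derivation ℝ R R [⋀^Fin k]→ₗ[R] R) (Y : Fin k → Derivation ℝ R R) :
    vectorFieldLie (-D) s Y = -vectorFieldLie D s Y := by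
  simp only [vectorFieldLie, cochainLie, neg_lie, AlternatingMap.map_update_neg,
    Finset.sum_neg_distrib, Derivation.neg_apply]
  ring

namespace IsLieBialgebroid

variable {𝒜 : LieAlgebroid R L} {𝒜' : LieAlgebroid R (Dual R L)}

theorem anchor_dFun_antisymm (h : IsLieBialgebroid 𝒜 𝒜') (f g : R) :
    𝒜'.anchor (𝒜.dFun f) g = -𝒜'.anchor (𝒜.dFun g) f := by
  have := congrFun (h.fun_fun f g) Fin.elim0
  simp [LieAlgebroid.schoutenFun, insertFirst, LieAlgebroid.d, zeroVec] at this
  linear_combination this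

variable [IsReflexive R L]

/-- The section `d_* f` of `A`. -/
def dStar (𝒜' : LieAlgebroid R (Dual R L)) (f : R) : L :=
  (evalEquiv R L).symm (𝒜'.dFun f)

theorem apply_dStar (𝒜' : LieAlgebroid R (Dual R L)) (f : R) (θ : Dual R L) :
    θ (dStar 𝒜' f) = 𝒜'.anchor θ f := by
  have h : Dual.eval R L (dStar 𝒜' f) = 𝒜'.dFun f := (evalEquiv R L).apply_symm_apply _
  exact congrArg (fun φ => φ θ) h

theorem anchor_dStar (h : IsLieBialgebroid 𝒜 𝒜') (f : R) :
    𝒜.anchor (dStar 𝒜' f) = -𝒜'.anchor (𝒜.dFun f) := by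
  ext g
  have := apply_dStar 𝒜' f (𝒜.dFun g)
  rw [h.anchor_dFun_antisymm] at this
  exact this

/-- Evaluate the compatibility in degrees (1, 0) on `θ`: the terms ρ_*(θ)(ρ(X) f) on the two sides
cancel, leaving the pairings of `θ` with L_{df} X and with [X, d_*f]. -/
theorem lieBidual_dFun (h : IsLieBialgebroid 𝒜 𝒜') (f : R) (X : L) :
    lieBidual 𝒜' (𝒜.dFun f) X = 𝒜.bracket X (dStar 𝒜' f) := by
  apply (bijective_dual_eval R L).1
  ext1 θ
  change θ _ = θ _
  have h1 := congrFun (h.sec_fun X f) fun _ => θ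
  rw [Pi.add_apply, LieAlgebroid.schoutenFun, Pi.smul_apply, insertFirst,
    LieAlgebroid.d_cons_const] at h1
  have h2 := apply_dStar 𝒜' f (𝒜.lieDual X θ)
  have h3 := apply_dStar 𝒜' f θ
  have h4 : 𝒜.lieDual X θ (dStar 𝒜' f) =
    𝒜.anchor X (θ (dStar 𝒜' f)) - θ (𝒜.bracket X (dStar 𝒜' f)) := rfl
  rw [apply_lieBidual]
  simp only [LieAlgebroid.d, zeroVec, oneVec, LieAlgebroid.lieVec, cochainLie,
    Fin.sum_univ_succ, Finset.univ_eq_empty, Finset.sum_empty, add_zero, Function.update_self,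
    pow_one, smul_eq_mul] at h1
  have h5 : 𝒜.dFun f X = 𝒜.anchor X f := rfl
  rw [h5] at h1
  rw [← h3] at h1
  rw [← h2] at h1
  rw [h4] at h1
  linear_combination h1

/-- The operators L_{df} and L_{d_*f} are opposite both on functions and on sections, hence on
forms. -/
theorem lieCovec_dFun (h : IsLieBialgebroid 𝒜 𝒜') (f : R) {k : ℕ} (Ω : L [⋀^Fin k]→ₗ[R] R)
    (u : Fin k → L) :
    lieCovec 𝒜' (𝒜.dFun f) Ω u = -𝒜.lieForm (dStar 𝒜' f) Ω u := by
  have hb : ∀ X, 𝒜.bracket X (dStar 𝒜' f) = -𝒜.bracket (dStar 𝒜' f) X := fun X =>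
    𝒜.bracket_swap _ _
  simp only [lieCovec, LieAlgebroid.lieForm, cochainLie, h.lieBidual_dFun, hb,
    AlternatingMap.map_update_neg, Finset.sum_neg_distrib, h.anchor_dStar, Derivation.neg_apply]
  ring

end IsLieBialgebroid

theorem LieAlgebroid.isBV_of_lieForm (𝒜 : LieAlgebroid R L) {k : ℕ}
    (htop : ∀ β : L [⋀^Fin (k + 2)]→ₗ[R] R, β = 0) (Ω : L [⋀^Fin (k + 1)]→ₗ[R] R) {X : L} {f : R}
    (h : ∀ u, 𝒜.lieForm X Ω u = -(f * Ω u)) : 𝒜.IsBV Ω X f := by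
  change f • ⇑Ω = -𝒜.d (insertFirst X Ω)
  rw [𝒜.d_insertFirst_of_top htop]
  ext u
  rw [Pi.neg_apply, h, neg_neg]
  rfl

end Bialgebroid

end

/-! ### The identities for the modular cocycles -/

theorem corollary2p5
    {𝕜 : Type*} [RCLike 𝕜] {m n : ℕ}
    {M : Type*} [TopologicalSpace M] [ChartedSpace (EuclideanSpace ℝ (Fin m)) M]
    [IsManifold (𝓡 m) ∞ M] [T2Space M] [SecondCountableTopology M]
    {F : Type*} [NormedAddCommGroup F] [NormedSpace ℝ F] [NormedSpace 𝕜 F] [IsScalarTower ℝ 𝕜 F]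
    [FiniteDimensional 𝕜 F] (hn : finrank 𝕜 F = n)
    {A : M → Type*} [TopologicalSpace (TotalSpace F A)] [∀ x, TopologicalSpace (A x)]
    [∀ x, AddCommGroup (A x)] [∀ x, Module ℝ (A x)] [∀ x, Module 𝕜 (A x)]
    [FiberBundle F A] [VectorBundle ℝ F A] [VectorBundle 𝕜 F A]
    [ContMDiffVectorBundle ∞ F A (𝓡 m)]
    (𝒜 : LieAlgebroid (SmoothFun m M 𝕜) (SmoothSec m F A))
    (𝒜' : LieAlgebroid (SmoothFun m M 𝕜) (Dual (SmoothFun m M 𝕜) (SmoothSec m F A)))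
    (hbi : IsLieBialgebroid 𝒜 𝒜')
    (s : Derivation ℝ (SmoothFun m M 𝕜) (SmoothFun m M 𝕜) [⋀^Fin m]→ₗ[SmoothFun m M 𝕜]
      SmoothFun m M 𝕜) (hs : NowhereVanishing s)
    (Ω : SmoothSec m F A [⋀^Fin n]→ₗ[SmoothFun m M 𝕜] SmoothFun m M 𝕜) (hΩ : NowhereVanishing Ω)
    (V : Dual (SmoothFun m M 𝕜) (SmoothSec m F A) [⋀^Fin n]→ₗ[SmoothFun m M 𝕜] SmoothFun m M 𝕜)
    (hV : IsDualVolume Ω V)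
    (X₀ : SmoothSec m F A) (hX₀ : IsModularCocycleDual 𝒜' Ω s X₀)
    (ξ₀ : Dual (SmoothFun m M 𝕜) (SmoothSec m F A)) (hξ₀ : IsModularCocycle 𝒜 s V ξ₀) :
    𝒜.lieVec X₀ V = -𝒜'.lieForm ξ₀ V ∧
    𝒜.lieForm X₀ Ω = -lieCovec 𝒜' ξ₀ Ω ∧
    (∃ f : SmoothFun m M 𝕜, 𝒜'.IsBV V ξ₀ f ∧ 𝒜.IsBV Ω X₀ f) ∧
    vectorFieldLie (𝒜.anchor X₀) s = vectorFieldLie (𝒜'.anchor ξ₀) s := by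
  have hL : HasLocalFrames m M 𝕜 (SmoothSec m F A) n := hn ▸ hasLocalFrames_smoothSec
  have hVn := hL.nowhereVanishing_dual hΩ hV
  choose c hc using fun X => hL.dual.exists_eq_mul
    ((𝒜.isModuleDerivation_lieDual X).altLie V) V hVn
  choose c' hc' using fun θ => hL.exists_eq_mul
    ((isModuleDerivation_lieBidual 𝒜' θ).altLie Ω) Ω hΩ
  choose dv hdv using fun D => hasLocalFrames_derivation.exists_eq_mul
    ((isModuleDerivation_lie D).altLie s) s hs
  replace hc : ∀ X θ, 𝒜.lieVec X V θ = c X * V θ := hc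
  replace hc' : ∀ θ u, lieCovec 𝒜' θ Ω u = c' θ * Ω u := hc'
  replace hdv : ∀ D Y, vectorFieldLie D s Y = dv D * s Y := hdv
  have hform : ∀ X u, 𝒜.lieForm X Ω u = -(c X * Ω u) := fun X u =>
    SmoothFun.eq_of_mul_eq_mul hVn fun θ => by
      have h := hV.lieForm_add_lieVec 𝒜 X u θ
      rw [hc] at h
      linear_combination h
  have hform' : ∀ θ η, 𝒜'.lieForm θ V η = -(c' θ * V η) := fun θ η =>
    SmoothFun.eq_of_mul_eq_mul hΩ fun u => by
      have h := hV.lieCovec_add_lieForm 𝒜' θ u η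
      rw [hc'] at h
      linear_combination h
  have hX : ∀ θ, θ X₀ = c' θ + dv (𝒜'.anchor θ) := fun θ =>
    SmoothFun.eq_of_mul_eq_mul (b := fun p : (Fin n → _) × (Fin m → _) => Ω p.1 * s p.2)
      (fun x => by
        obtain ⟨u, hu⟩ := hΩ x
        obtain ⟨Y, hY⟩ := hs x
        exact ⟨(u, Y), mul_ne_zero hu hY⟩)
      fun p => by
        have h := hX₀ θ p.1 p.2
        rw [hc', hdv] at h
        linear_combination -h
  have hξ : ∀ u, ξ₀ u = c u + dv (𝒜.anchor u) := fun u =>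
    SmoothFun.eq_of_mul_eq_mul (b := fun p : (Fin m → _) × (Fin n → _) => s p.1 * V p.2)
      (fun x => by
        obtain ⟨θ, hθ⟩ := hVn x
        obtain ⟨Y, hY⟩ := hs x
        exact ⟨(Y, θ), mul_ne_zero hY hθ⟩)
      fun p => by
        have h := hξ₀ u p.1 p.2
        rw [hc, hdv] at h
        linear_combination -h
  -- Two signs cancel: L_{df} Ω = -L_{d_*f} Ω, and the factor of `Ω` is opposite to that of `V`.
  have hcd : ∀ f, c' (𝒜.dFun f) = c (IsLieBialgebroid.dStar 𝒜' f) := fun f =>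
    SmoothFun.eq_of_mul_eq_mul hΩ fun u => by
      rw [← hc', hbi.lieCovec_dFun, hform, neg_neg]
  have hdneg : ∀ D, dv (-D) = -dv D := fun D => SmoothFun.eq_of_mul_eq_mul hs fun Y => by
    rw [← hdv, vectorFieldLie_neg, hdv, neg_mul]
  have hdiv : dv (𝒜.anchor X₀) = dv (𝒜'.anchor ξ₀) := by
    refine sub_eq_zero.1 (divergence_modular_eq_zero hs
      (P := fun f => 𝒜'.anchor (𝒜.dFun f)) hbi.anchor_dFun_antisymm (fun f Y => hdv _ Y)
      (Z := 𝒜.anchor X₀ - 𝒜'.anchor ξ₀) (fun f => ?_) fun Y => ?_)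
    · have h1 := hX (𝒜.dFun f)
      have h2 := hξ (IsLieBialgebroid.dStar 𝒜' f)
      rw [IsLieBialgebroid.apply_dStar, hbi.anchor_dStar, hdneg, ← hcd] at h2
      have h3 : 𝒜.dFun f X₀ = 𝒜.anchor X₀ f := rfl
      rw [h3] at h1
      rw [Derivation.sub_apply, h1, h2]
      ring
    · rw [vectorFieldLie_sub, hdv, hdv, sub_mul]
  -- Both cocycle formulas compute ⟨ξ₀, X₀⟩, and their divergence terms agree by `hdiv`.
  have hcc : c X₀ = c' ξ₀ := by
    have h1 := hX ξ₀
    rw [hξ X₀, hdiv] at h1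
    exact add_right_cancel h1
  refine ⟨?_, ?_, ?_, ?_⟩
  · ext1 θ
    rw [Pi.neg_apply, hc, hform', neg_neg, hcc]
  · ext1 u
    rw [Pi.neg_apply, hc', hform, hcc]
  · cases n with
    -- In rank zero the contractions of `Ω` and `V` are zero, so both functions are 0.
    | zero => exact ⟨0, zero_smul _ _, zero_smul _ _⟩
    | succ k =>
      exact ⟨c X₀, 𝒜'.isBV_of_lieForm hL.dual.eq_zero_of_succ V (hcc ▸ hform' ξ₀),
        𝒜.isBV_of_lieForm hL.eq_zero_of_succ Ω (hform X₀)⟩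
  · ext1 Y
    rw [hdv, hdv, hdiv]
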